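/- **Setting.** For $\mathcal A\in\mathbb R^{n_1\times n_2\times n_3}$ let $\widehat{\mathcal A}$ be the tensor obtained by applying the orthonormal (type II) discrete cosine transform to every tube $\mathcal A(i,j,:)$, let $\widehat{\mathcal A}^{(k)}$ be its $k$-th frontal slice and $\overline{\mathcal A}=\operatorname{blockdiag}(\widehat{\mathcal A}^{(1)},\dots,\widehat{\mathcal A}^{(n_3)})$. The product $\mathcal A*\mathcal B$ and the transpose $\mathcal A^T$ are defined slicewise in the transform domain: $\overline{\mathcal A*\mathcal B}=\overline{\mathcal A}\,\overline{\mathcal B}$, $\overline{\mathcal A^T}=\overline{\mathcal A}^T$. The transformed multi-rank is $\operatorname{rank}_t(\mathcal A)=(\operatorname{rank}\widehat{\mathcal A}^{(k)})_{k}$, and $\sigma_{\min}(\mathcal A)$ is the smallest nonzero singular value of $\overline{\mathcal A}$. For a multi-rank $\mathbf r=(r_1,\dots,r_{n_3})$ put $r=\max_k r_k$, and let $\mathcal I_{\mathbf r}\in\mathbb R^{r\times r\times n_3}$ be the tensor with $\widehat{\mathcal I_{\mathbf r}}^{(k)}=\operatorname{diag}(I_{r_k},0)$. A skinny $t_c$-SVD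 of a tensor of multi-rank $\mathbf r$ is $\mathcal A=\mathcal U*\mathcal S*\mathcal V^T$ with $\mathcal U\in\mathbb R^{n_1\times r\times n_3}$, $\mathcal V\in\mathbb R^{n_2\times r\times n_3}$ of multi-rank $\mathbf r$, $\mathcal U^T*\mathcal U=\mathcal V^T*\mathcal V=\mathcal I_{\mathbf r}$, and $\mathcal S\in\mathbb R^{r\times r\times n_3}$ with diagonal frontal slices. The associated tangent projection is $$P(\mathcal Z)=\mathcal U*\mathcal U^T*\mathcal Z+\mathcal Z*\mathcal V*\mathcal V^T-\mathcal U*\mathcal U^T*\mathcal Z*\mathcal V*\mathcal V^T.$$ The truncation $H_{\mathbf r}(\mathcal W)$ keeps, in an SVD of each $\widehat{\mathcal W}^{(k)}$, the $r_k$ largest singular values and the corresponding singular vectors (ties broken arbitrarily). Let $m\ge1$, let $\Omega=(\omega_1,\dots,\omega_m)$ be a family of index triples (repetitions allowed), $R_\Omega(\mathcal Z)=\sum_{t=1}^m\langle\mathcal E_{\omega_t},\mathcal Z\rangle\mathcal E_{\omega_t}$ with $\mathcal E_\omega$ the tensor whose only nonzero entry is a $1$ at position $\omega$, $p=m/(n_1n_2n_3)$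 and $n=\max\{n_1,n_2,n_3\}$. Norms of operators are operator norms with respect to $\|\cdot\|_F$. **Algorithm (restarted tensor Riemannian conjugate gradient descent, parameters $k_1,k_2\ge0$).** Start from $\mathcal X_0=\mathcal U_0*\mathcal S_0*\mathcal V_0^T$, a skinny $t_c$-SVD with $\operatorname{rank}_t(\mathcal X_0)=\mathbf r$, and put $\mathcal Q_{-1}=0$, $\beta_0=0$. For $l=0,1,\dots$, with $P_l$ the tangent projection given by $\mathcal U_l,\mathcal V_l$ (for $l\ge1$ the factors produced by the truncation), let $\mathcal G_l=R_\Omega(\mathcal X-\mathcal X_l)$; for $l\ge1$, let $\beta_l=-\frac{\langle P_l\mathcal G_l,\,R_\Omega P_l\mathcal Q_{l-1}\rangle}{\langle P_l\mathcal Q_{l-1},\,R_\Omega P_l\mathcal Q_{l-1}\rangle}$ if $$\frac{|\langle P_l\mathcal G_l,P_l\mathcal Q_{l-1}\rangle|}{\|P_l\mathcal G_l\|_F\|P_l\mathcal Q_{l-1}\|_F}\le k_1\quad\text{and}\quad \|P_l\mathcal G_l\|_F\le k_2\|P_l\mathcal Q_{l-1}\|_F,$$ and $\beta_l=0$ (restart)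 otherwise; then $$\mathcal Q_l=P_l\mathcal G_l+\beta_lP_l\mathcal Q_{l-1},\quad \alpha_l=\frac{\langle P_l\mathcal G_l,P_l\mathcal Q_l\rangle}{\langle P_l\mathcal Q_l,R_\Omega P_l\mathcal Q_l\rangle},\quad \mathcal W_l=\mathcal X_l+\alpha_l\mathcal Q_l,\quad \mathcal X_{l+1}=H_{\mathbf r}(\mathcal W_l).$$ (Quotients $0/0$ are read as $0$.) **Constants.** $$\gamma_1=\frac{18\epsilon_0-10k_1\epsilon_0(1+4\epsilon_0)}{(1-4\epsilon_0)-k_1(1+4\epsilon_0)}+\frac{4k_2\epsilon_0+k_1k_2}{1-4\epsilon_0},\quad \gamma_2=\frac{8k_2\epsilon_0+2k_1k_2}{1-4\epsilon_0},\quad v_{cg}=\tfrac12\Big(\gamma_1+\sqrt{\gamma_1^2+4\gamma_2}\Big).$$ **Theorem 3.1.** (a) Let $\mathcal X=\mathcal U*\mathcal S*\mathcal V^T$ be a skinny $t_c$-SVD with $\operatorname{rank}_t(\mathcal X)=\mathbf r$ and let $P_{\mathbb T}$ be the tangent projection given by $\mathcal U,\mathcal V$. Let $\beta>1$, $k_1,k_2\ge0$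 and $\epsilon_0>0$ satisfy $$\|R_\Omega\|\le\tfrac{10}3\beta\log n,\qquad \|P_{\mathbb T}-p^{-1}P_{\mathbb T}R_\Omega P_{\mathbb T}\|\le\epsilon_0,\qquad \frac{\|\mathcal X_0-\mathcal X\|_F}{\sigma_{\min}(\mathcal X)}\le\frac{3p^{1/2}\epsilon_0}{20\beta(1+\epsilon_0)\log n},$$ together with $(1-4\epsilon_0)-k_1(1+4\epsilon_0)>0$ and $\gamma_1+\gamma_2<1$. Then $v_{cg}<1$, and all iterates of the algorithm satisfy $$\|\mathcal X_l-\mathcal X\|_F\le v_{cg}^{\,l}\,\|\mathcal X_0-\mathcal X\|_F\qquad(l\ge0).$$ (b) If $k_1=k_2=0$ and $0<\epsilon_0<\frac14$, then $v_{cg}=\frac{18\epsilon_0}{1-4\epsilon_0}$, and this is $<1$ whenever $\gamma_1+\gamma_2<1$. (c) For $k_1,k_2\ge0$ with $k_1\ne1$, $\lim_{\epsilon_0\to0}(\gamma_1+\gamma_2)=3k_1k_2$. If $k_1,k_2\ge0$ and $k_1k_2<\frac13$, then $\gamma_1+\gamma_2<1$ for all sufficiently small $\epsilon_0>0$. (d)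 For $k_1=0.1$, $k_2=1$ and every $0<\epsilon_0\le0.01$, one has $(1-4\epsilon_0)-k_1(1+4\epsilon_0)>0$ and $\gamma_1+\gamma_2<1$. -/

import Mathlib

noncomputable section

open scoped InnerProductSpace

namespace TensorRCG

/-- Real third-order tensors of size `a × b × c`. The norm is the Frobenius norm and the inner
product is the entrywise one. The entry at position `(i, j, k)` of `A` is `A (i, j, k)`. -/
abbrev Tensor (a b c : ℕ) : Type := EuclideanSpace ℝ (Fin a × Fin b × Fin c)

/-- The tensor with prescribed entries. -/
def mk {a b c : ℕ} (f : Fin a → Fin b → Fin c → ℝ) : Tensor a b c :=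
  WithLp.toLp 2 fun x => f x.1 x.2.1 x.2.2

@[simp] theorem mk_apply {a b c : ℕ} (f : Fin a → Fin b → Fin c → ℝ)
    (x : Fin a × Fin b × Fin c) : mk f x = f x.1 x.2.1 x.2.2 := rfl

/-- The `k`-th frontal slice. -/
def slice {a b c : ℕ} (A : Tensor a b c) (k : Fin c) : Matrix (Fin a) (Fin b) ℝ :=
  Matrix.of fun i j => A (i, j, k)

/-! ### The discrete cosine transform -/

/-- The orthonormal (type II) discrete cosine transform matrix. -/
def dctMatrix (n : ℕ) : Matrix (Fin n) (Fin n) ℝ :=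
  Matrix.of fun k j =>
    Real.sqrt ((if k.val = 0 then 1 else 2) / n) *
      Real.cos (Real.pi * (2 * (j.val : ℝ) + 1) * k.val / (2 * n))

theorem sum_cos_odd (n : ℕ) (x : ℝ) :
    (∑ j : Fin n, Real.cos ((2 * (j.val : ℝ) + 1) * x)) * (2 * Real.sin x) =
      Real.sin (2 * n * x) := by
  rw [Fin.sum_univ_eq_sum_range (fun j : ℕ => Real.cos ((2 * (j : ℝ) + 1) * x))]
  induction n with
  | zero => simp
  | succ n ih =>
    rw [Finset.sum_range_succ, add_mul, ih]
    have h1 : 2 * ((n + 1 : ℕ) : ℝ) * x = (2 * (n : ℝ) + 1) * x + x := by push_cast; ring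
    have h2 : 2 * (n : ℝ) * x = (2 * (n : ℝ) + 1) * x - x := by ring
    rw [h1, h2, Real.sin_add, Real.sin_sub]
    ring

theorem sum_cos_int (n : ℕ) (m : ℤ) (h0 : m ≠ 0) (h1 : |m| < 2 * n) :
    ∑ j : Fin n, Real.cos ((2 * (j.val : ℝ) + 1) * (Real.pi * m / (2 * n))) = 0 := by
  have hn : 0 < n := by
    have := abs_nonneg m
    omega
  have hn' : (0 : ℝ) < n := by exact_mod_cast hn
  have key := sum_cos_odd n (Real.pi * m / (2 * n))
  have e : 2 * (n : ℝ) * (Real.pi * m / (2 * n)) = m * Real.pi := by field_simp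
  rw [e, Real.sin_int_mul_pi] at key
  have hs : Real.sin (Real.pi * m / (2 * n)) ≠ 0 := by
    intro hs
    rw [Real.sin_eq_zero_iff] at hs
    obtain ⟨q, hq⟩ := hs
    have hq' : (m : ℝ) = q * (2 * n) := by
      have hpi := Real.pi_ne_zero
      field_simp at hq
      linarith
    have hq2 : m = q * (2 * n) := by exact_mod_cast hq'
    have hq0 : q ≠ 0 := by
      rintro rfl
      exact h0 (by simpa using hq2)
    have : 1 ≤ |q| := Int.one_le_abs hq0
    rw [hq2, abs_mul, abs_of_nonneg (by positivity : (0 : ℤ) ≤ 2 * n)] at h1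
    nlinarith
  rcases mul_eq_zero.1 key with h | h
  · exact h
  · exact absurd (by linarith : Real.sin (Real.pi * m / (2 * n)) = 0) hs

/-- The cosine transform matrix is orthogonal. -/
theorem dctMatrix_mul_transpose (n : ℕ) : dctMatrix n * (dctMatrix n).transpose = 1 := by
  ext k l
  have hn : 0 < n := k.pos
  have hn' : (0 : ℝ) < n := by exact_mod_cast hn
  have split : ∀ j : Fin n,
      Real.cos (Real.pi * (2 * (j.val : ℝ) + 1) * k.val / (2 * n)) *
        Real.cos (Real.pi * (2 * (j.val : ℝ) + 1) * l.val / (2 * n)) =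
      (1 / 2) * (Real.cos ((2 * (j.val : ℝ) + 1) *
          (Real.pi * (((k.val : ℤ) - l.val : ℤ) : ℝ) / (2 * n))) +
        Real.cos ((2 * (j.val : ℝ) + 1) *
          (Real.pi * (((k.val : ℤ) + l.val : ℤ) : ℝ) / (2 * n)))) := by
    intro j
    have h1 : (2 * (j.val : ℝ) + 1) * (Real.pi * (((k.val : ℤ) - l.val : ℤ) : ℝ) / (2 * n)) =
        Real.pi * (2 * (j.val : ℝ) + 1) * k.val / (2 * n) -
          Real.pi * (2 * (j.val : ℝ) + 1) * l.val / (2 * n) := by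
      push_cast; ring
    have h2 : (2 * (j.val : ℝ) + 1) * (Real.pi * (((k.val : ℤ) + l.val : ℤ) : ℝ) / (2 * n)) =
        Real.pi * (2 * (j.val : ℝ) + 1) * k.val / (2 * n) +
          Real.pi * (2 * (j.val : ℝ) + 1) * l.val / (2 * n) := by
      push_cast; ring
    rw [h1, h2, Real.cos_sub, Real.cos_add]
    ring
  have expand : (dctMatrix n * (dctMatrix n).transpose) k l =
      Real.sqrt ((if k.val = 0 then 1 else 2) / n) *
        Real.sqrt ((if l.val = 0 then 1 else 2) / n) *
      ((1 / 2) * (∑ j : Fin n, Real.cos ((2 * (j.val : ℝ) + 1) *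
          (Real.pi * (((k.val : ℤ) - l.val : ℤ) : ℝ) / (2 * n))) +
        ∑ j : Fin n, Real.cos ((2 * (j.val : ℝ) + 1) *
          (Real.pi * (((k.val : ℤ) + l.val : ℤ) : ℝ) / (2 * n))))) := by
    rw [Matrix.mul_apply, ← Finset.sum_add_distrib, Finset.mul_sum, Finset.mul_sum]
    refine Finset.sum_congr rfl fun j _ => ?_
    rw [← split j]
    simp only [dctMatrix, Matrix.of_apply, Matrix.transpose_apply]
    ring
  rw [expand]
  have hk := k.isLt
  have hl := l.isLt
  by_cases hkl : k = l
  · subst hkl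
    rw [Matrix.one_apply_eq, Real.mul_self_sqrt (by positivity)]
    by_cases h0 : k.val = 0
    · simp [h0]
      field_simp
      norm_num
    · rw [sum_cos_int n ((k.val : ℤ) + k.val) (by omega)
        (by rw [abs_of_nonneg (by positivity)]; omega)]
      simp [h0]
      field_simp
  · have hne : k.val ≠ l.val := fun h => hkl (Fin.ext h)
    rw [Matrix.one_apply_ne hkl, sum_cos_int n ((k.val : ℤ) - l.val) (by omega)
      (by rw [abs_lt]; constructor <;> omega),
      sum_cos_int n ((k.val : ℤ) + l.val) (by omega)
        (by rw [abs_of_nonneg (by positivity)]; omega)]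
    simp

theorem transpose_mul_dctMatrix (n : ℕ) : (dctMatrix n).transpose * dctMatrix n = 1 :=
  mul_eq_one_comm.1 (dctMatrix_mul_transpose n)

/-- The cosine transform of all tubes (third dimension). -/
def dct {a b c : ℕ} (A : Tensor a b c) : Tensor a b c :=
  mk fun i j k => ∑ l, dctMatrix c k l * A (i, j, l)

/-- The inverse cosine transform of all tubes. -/
def idct {a b c : ℕ} (A : Tensor a b c) : Tensor a b c :=
  mk fun i j k => ∑ l, dctMatrix c l k * A (i, j, l)

theorem idct_dct {a b c : ℕ} (A : Tensor a b c) : idct (dct A) = A := by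
  ext ⟨i, j, k⟩
  have h := congrFun (congrArg Matrix.mulVec (transpose_mul_dctMatrix c)) (fun l => A (i, j, l))
  rw [← Matrix.mulVec_mulVec, Matrix.one_mulVec] at h
  exact congrFun h k

theorem dct_idct {a b c : ℕ} (A : Tensor a b c) : dct (idct A) = A := by
  ext ⟨i, j, k⟩
  have h := congrFun (congrArg Matrix.mulVec (dctMatrix_mul_transpose c)) (fun l => A (i, j, l))
  rw [← Matrix.mulVec_mulVec, Matrix.one_mulVec] at h
  exact congrFun h k

/-! ### The tensor algebra -/

/-- The block diagonal matrix of a tensor in the transform domain. -/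
def bdiag {a b c : ℕ} (A : Tensor a b c) : Matrix (Fin a × Fin c) (Fin b × Fin c) ℝ :=
  Matrix.blockDiagonal (slice (dct A))

/-- The tensor whose frontal slices are the diagonal blocks of a matrix. -/
def fold {a b c : ℕ} (M : Matrix (Fin a × Fin c) (Fin b × Fin c) ℝ) : Tensor a b c :=
  mk fun i j k => Matrix.blockDiag M k i j

/-- The `t_c`-product. -/
def tprod {a b d c : ℕ} (A : Tensor a b c) (B : Tensor b d c) : Tensor a d c :=
  idct (fold (bdiag A * bdiag B))

infixl:70 " ∗ₜ " => tprod

/-- The transpose of a tensor with respect to the cosine transform. -/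
def tr {a b c : ℕ} (A : Tensor a b c) : Tensor b a c :=
  idct (fold (bdiag A).transpose)

/-- The identity tensor with respect to the cosine transform. -/
def idTensor (a c : ℕ) : Tensor a a c :=
  idct (mk fun i j _ => if i = j then 1 else 0)

def IsOrthogonal {a c : ℕ} (A : Tensor a a c) : Prop :=
  tr A ∗ₜ A = idTensor a c ∧ A ∗ₜ tr A = idTensor a c

/-- Every frontal slice is a diagonal matrix. -/
def IsDiagonal {a b c : ℕ} (A : Tensor a b c) : Prop :=
  ∀ i j k, i.val ≠ j.val → A (i, j, k) = 0

/-- The transformed multi-rank. -/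
def multiRank {a b c : ℕ} (A : Tensor a b c) : Fin c → ℕ :=
  fun k => (slice (dct A) k).rank

/-- The largest entry of a multi-rank vector: the tubal rank. -/
def maxRank {c : ℕ} (r : Fin c → ℕ) : ℕ := Finset.univ.sup r

/-- The tensor of size `maxRank r × maxRank r × c` whose `k`-th frontal slice in the transform
domain is `diag (I_{r k}, 0)`. -/
def partialId {c : ℕ} (r : Fin c → ℕ) : Tensor (maxRank r) (maxRank r) c :=
  idct (mk fun i j k => if i = j ∧ i.val < r k then 1 else 0)

/-- The skinny `t_c`-SVD `A = U ∗ₜ S ∗ₜ Vᵀ` of a tensor `A` of transformed multi-rank `r`. -/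
structure IsSkinnySVD {a b c : ℕ} (r : Fin c → ℕ) (A : Tensor a b c)
    (U : Tensor a (maxRank r) c) (S : Tensor (maxRank r) (maxRank r) c)
    (V : Tensor b (maxRank r) c) : Prop where
  multiRank_eq : multiRank A = r
  eq : A = U ∗ₜ S ∗ₜ tr V
  left : tr U ∗ₜ U = partialId r
  right : tr V ∗ₜ V = partialId r
  multiRank_left : multiRank U = r
  multiRank_right : multiRank V = r
  diagonal : IsDiagonal S

/-- The full `t_c`-SVD: in the transform domain every frontal slice is a singular value
decomposition, with nonnegative singular values in nonincreasing order. -/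
structure IsFullSVD {a b c : ℕ} (A : Tensor a b c) (U : Tensor a a c) (S : Tensor a b c)
    (V : Tensor b b c) : Prop where
  eq : A = U ∗ₜ S ∗ₜ tr V
  left : IsOrthogonal U
  right : IsOrthogonal V
  diagonal : IsDiagonal S
  nonneg : ∀ (i : Fin a) (j : Fin b) (k : Fin c), i.val = j.val → 0 ≤ dct S (i, j, k)
  antitone : ∀ (i i' : Fin a) (j j' : Fin b) (k : Fin c), i.val = j.val → i'.val = j'.val →
    i.val ≤ i'.val → dct S (i', j', k) ≤ dct S (i, j, k)

/-- Keep, in the `k`-th frontal slice in the transform domain, the first `r k` columns (padded by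
zero columns to the common width `maxRank r`). -/
def truncCols {a c : ℕ} (r : Fin c → ℕ) (U : Tensor a a c) : Tensor a (maxRank r) c :=
  idct (mk fun i j k => if h : j.val < r k ∧ j.val < a then dct U (i, ⟨j.val, h.2⟩, k) else 0)

/-- Keep, in the `k`-th frontal slice in the transform domain, the first `r k` diagonal entries. -/
def truncDiag {a b c : ℕ} (r : Fin c → ℕ) (S : Tensor a b c) :
    Tensor (maxRank r) (maxRank r) c :=
  idct (mk fun i j k =>
    if h : i = j ∧ i.val < r k ∧ i.val < a ∧ j.val < b then
      dct S (⟨i.val, h.2.2.1⟩, ⟨j.val, h.2.2.2⟩, k) else 0)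

/-- `U`, `S`, `V` are the factors of a `t_c`-SVD of `W` truncated to multi-rank `r`; the truncation
of `W` is then `U ∗ₜ S ∗ₜ tr V`. -/
def IsTruncatedSVD {a b c : ℕ} (r : Fin c → ℕ) (W : Tensor a b c)
    (U : Tensor a (maxRank r) c) (S : Tensor (maxRank r) (maxRank r) c)
    (V : Tensor b (maxRank r) c) : Prop :=
  ∃ U' S' V', IsFullSVD W U' S' V' ∧ U = truncCols r U' ∧ S = truncDiag r S' ∧ V = truncCols r V'

/-- The smallest nonzero singular value of the block diagonal matrix of a tensor in the transform
domain. -/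
def sigmaMin {a b c : ℕ} (A : Tensor a b c) : ℝ :=
  sInf {s : ℝ | 0 < s ∧ ∃ i : ℕ, (Matrix.toEuclideanLin (bdiag A)).singularValues i = s}

/-! ### Linearity of the product -/

theorem dct_add {a b c : ℕ} (A B : Tensor a b c) : dct (A + B) = dct A + dct B := by
  ext x; simp [dct, mul_add, Finset.sum_add_distrib]

theorem dct_smul {a b c : ℕ} (t : ℝ) (A : Tensor a b c) : dct (t • A) = t • dct A := by
  ext x; simp [dct, Finset.mul_sum, mul_left_comm]

theorem idct_add {a b c : ℕ} (A B : Tensor a b c) : idct (A + B) = idct A + idct B := by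
  ext x; simp [idct, mul_add, Finset.sum_add_distrib]

theorem idct_smul {a b c : ℕ} (t : ℝ) (A : Tensor a b c) : idct (t • A) = t • idct A := by
  ext x; simp [idct, Finset.mul_sum, mul_left_comm]

theorem bdiag_add {a b c : ℕ} (A B : Tensor a b c) : bdiag (A + B) = bdiag A + bdiag B := by
  rw [bdiag, dct_add, bdiag, bdiag, ← Matrix.blockDiagonal_add]; rfl

theorem bdiag_smul {a b c : ℕ} (t : ℝ) (A : Tensor a b c) : bdiag (t • A) = t • bdiag A := by
  rw [bdiag, dct_smul, bdiag, ← Matrix.blockDiagonal_smul]; rfl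

theorem fold_add {a b c : ℕ} (M N : Matrix (Fin a × Fin c) (Fin b × Fin c) ℝ) :
    fold (M + N) = fold M + fold N := rfl

theorem fold_smul {a b c : ℕ} (t : ℝ) (M : Matrix (Fin a × Fin c) (Fin b × Fin c) ℝ) :
    fold (t • M) = t • fold M := rfl

theorem tprod_add {a b d c : ℕ} (A : Tensor a b c) (B B' : Tensor b d c) :
    A ∗ₜ (B + B') = A ∗ₜ B + A ∗ₜ B' := by
  simp only [tprod, bdiag_add, Matrix.mul_add, fold_add, idct_add]

theorem add_tprod {a b d c : ℕ} (A A' : Tensor a b c) (B : Tensor b d c) :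
    (A + A') ∗ₜ B = A ∗ₜ B + A' ∗ₜ B := by
  simp only [tprod, bdiag_add, Matrix.add_mul, fold_add, idct_add]

theorem tprod_smul {a b d c : ℕ} (t : ℝ) (A : Tensor a b c) (B : Tensor b d c) :
    A ∗ₜ (t • B) = t • (A ∗ₜ B) := by
  simp only [tprod, bdiag_smul, Matrix.mul_smul, fold_smul, idct_smul]

theorem smul_tprod {a b d c : ℕ} (t : ℝ) (A : Tensor a b c) (B : Tensor b d c) :
    (t • A) ∗ₜ B = t • (A ∗ₜ B) := by
  simp only [tprod, bdiag_smul, Matrix.smul_mul, fold_smul, idct_smul]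

/-! ### Operators -/

/-- The orthogonal projection onto the tangent space
`{U ∗ₜ tr Z₁ + Z₂ ∗ₜ tr V}` of the fixed multi-rank manifold at `U ∗ₜ S ∗ₜ tr V`. The norm of such
a continuous linear map is the operator norm with respect to the Frobenius norm. -/
def tangentProj {a b d c : ℕ} (U : Tensor a d c) (V : Tensor b d c) :
    Tensor a b c →L[ℝ] Tensor a b c :=
  LinearMap.toContinuousLinearMap
    { toFun := fun A => U ∗ₜ tr U ∗ₜ A + A ∗ₜ V ∗ₜ tr V - U ∗ₜ tr U ∗ₜ A ∗ₜ V ∗ₜ tr V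
      map_add' := fun A B => by simp only [tprod_add, add_tprod]; abel
      map_smul' := fun t A => by
        simp only [tprod_smul, smul_tprod, RingHom.id_apply, smul_sub, smul_add] }

/-- The tensor with a single entry `1`. -/
def unitTensor {a b c : ℕ} (x : Fin a × Fin b × Fin c) : Tensor a b c :=
  EuclideanSpace.single x 1

/-- The sampling operator of a family of `m` indices, which may contain repetitions:
`Z ↦ ∑ₜ ⟨E_{Ω t}, Z⟩ E_{Ω t}`. -/
def samplingOp {a b c m : ℕ} (Ω : Fin m → Fin a × Fin b × Fin c) :
    Tensor a b c →L[ℝ] Tensor a b c :=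
  ∑ t, (innerSL ℝ (unitTensor (Ω t))).smulRight (unitTensor (Ω t))

/-! ### The algorithm -/

/-- The previous search direction, with the convention that the one before the first is zero. -/
def prevDir {E : Type*} [Zero E] (Q : ℕ → E) : ℕ → E
  | 0 => 0
  | l + 1 => Q l

/-- Both (non-)restarting conditions, for the projected residual `g` and the projected previous
search direction `q`. -/
def KeepsDirection {E : Type*} [NormedAddCommGroup E] [InnerProductSpace ℝ E]
    (k₁ k₂ : ℝ) (g q : E) : Prop :=
  |⟪g, q⟫_ℝ| / (‖g‖ * ‖q‖) ≤ k₁ ∧ ‖g‖ ≤ k₂ * ‖q‖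

/-- A run of the restarted tensor Riemannian conjugate gradient descent method for the completion of
`X` from the samples `Ω`, on the manifold of multi-rank `r`. Quotients `0 / 0` are read as `0`. -/
structure Run {a b c m : ℕ} (Ω : Fin m → Fin a × Fin b × Fin c) (X : Tensor a b c)
    (r : Fin c → ℕ) (k₁ k₂ : ℝ) where
  /-- the iterates -/
  iter : ℕ → Tensor a b c
  /-- the factors of the iterates -/
  U : ℕ → Tensor a (maxRank r) c
  S : ℕ → Tensor (maxRank r) (maxRank r) c
  V : ℕ → Tensor b (maxRank r) c
  /-- the residuals -/
  G : ℕ → Tensor a b c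
  /-- the search directions -/
  Q : ℕ → Tensor a b c
  /-- the points before truncation -/
  W : ℕ → Tensor a b c
  /-- the step sizes -/
  α : ℕ → ℝ
  /-- the orthogonalization weights -/
  β : ℕ → ℝ
  init : IsSkinnySVD r (iter 0) (U 0) (S 0) (V 0)
  G_eq : ∀ l, G l = samplingOp Ω (X - iter l)
  β_zero : β 0 = 0
  β_restart : ∀ l, ¬ KeepsDirection k₁ k₂ (tangentProj (U l) (V l) (G l))
    (tangentProj (U l) (V l) (prevDir Q l)) → β l = 0
  β_keep : ∀ l, l ≠ 0 → KeepsDirection k₁ k₂ (tangentProj (U l) (V l) (G l))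
    (tangentProj (U l) (V l) (prevDir Q l)) →
    β l = -(⟪tangentProj (U l) (V l) (G l),
          samplingOp Ω (tangentProj (U l) (V l) (prevDir Q l))⟫_ℝ /
        ⟪tangentProj (U l) (V l) (prevDir Q l),
          samplingOp Ω (tangentProj (U l) (V l) (prevDir Q l))⟫_ℝ)
  Q_eq : ∀ l, Q l = tangentProj (U l) (V l) (G l) +
    β l • tangentProj (U l) (V l) (prevDir Q l)
  α_eq : ∀ l, α l = ⟪tangentProj (U l) (V l) (G l), tangentProj (U l) (V l) (Q l)⟫_ℝ /
    ⟪tangentProj (U l) (V l) (Q l), samplingOp Ω (tangentProj (U l) (V l) (Q l))⟫_ℝ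
  W_eq : ∀ l, W l = iter l + α l • Q l
  trunc : ∀ l, IsTruncatedSVD r (W l) (U (l + 1)) (S (l + 1)) (V (l + 1))
  iter_succ : ∀ l, iter (l + 1) = U (l + 1) ∗ₜ S (l + 1) ∗ₜ tr (V (l + 1))

/-! ### The constants of the rate -/

def gamma₁ (k₁ k₂ ε : ℝ) : ℝ :=
  (18 * ε - 10 * k₁ * ε * (1 + 4 * ε)) / ((1 - 4 * ε) - k₁ * (1 + 4 * ε)) +
    (4 * k₂ * ε + k₁ * k₂) / (1 - 4 * ε)

def gamma₂ (k₁ k₂ ε : ℝ) : ℝ :=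
  (8 * k₂ * ε + 2 * k₁ * k₂) / (1 - 4 * ε)

def vcg (k₁ k₂ ε : ℝ) : ℝ :=
  (gamma₁ k₁ k₂ ε + Real.sqrt (gamma₁ k₁ k₂ ε ^ 2 + 4 * gamma₂ k₁ k₂ ε)) / 2

end TensorRCG

end

/-!
While the iterates stay close to `X`, the tangent space at `Xₗ` is close to that at `X`: a
perturbation of relative size `‖Xₗ - X‖ / σ_min(X)` moves the tangent projection by at most twice
that amount, and `X` itself deviates from the tangent space at `Xₗ` only quadratically. The
restricted isometry of the sampling operator therefore passes from the tangent space at `X` to the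
one at `Xₗ`, with constant `4 ε₀`. It makes the step size close to `p⁻¹` and bounds the conjugate
weight, so the error of `Wₗ` is at most a small multiple of `‖Xₗ - X‖` plus a multiple of the length
of the previous direction. By the Eckart–Young theorem the truncation is a best approximation, hence
at most doubles the error. The errors and the lengths of the directions thus satisfy a coupled
linear recursion, whose dominant characteristic root is `v_cg`.
-/

noncomputable section

open scoped InnerProductSpace

namespace TensorRCG

/-! ### Operators that are nearly isotropic on a subspace -/

section RestrictedIsometry

variable {E : Type*} [NormedAddCommGroup E] [InnerProductSpace ℝ E] {R : E →L[ℝ] E}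
  {K K₀ : Submodule ℝ E} [K.HasOrthogonalProjection] [K₀.HasOrthogonalProjection]
  {p δ ε L D : ℝ} {x y z : E}

/-- The restricted isometry property: compressed to the subspace `K`, the operator `R` is `p` times
the identity up to a relative error `δ`. -/
def RestrictedIsometry (K : Submodule ℝ E) [K.HasOrthogonalProjection] (R : E →L[ℝ] E)
    (p δ : ℝ) : Prop :=
  ‖K.starProjection - p⁻¹ • (K.starProjection ∘L R ∘L K.starProjection)‖ ≤ δ

/-- The vector `z` is nearly in the subspace `K`: its component normal to `K`, and what the
rescaled operator `R` returns of it to `K`, are small relative to `z`. -/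
def IsNearlyTangent (K : Submodule ℝ E) [K.HasOrthogonalProjection] (R : E →L[ℝ] E) (p ε : ℝ)
    (z : E) : Prop :=
  ‖z - K.starProjection z‖ + p⁻¹ * ‖K.starProjection (R (z - K.starProjection z))‖ ≤ ε * ‖z‖

theorem RestrictedIsometry.nonneg (h : RestrictedIsometry K R p δ) : 0 ≤ δ :=
  (norm_nonneg _).trans h

theorem RestrictedIsometry.norm_apply_le (h : RestrictedIsometry K R p δ) (z : E) :
    ‖K.starProjection z - p⁻¹ • K.starProjection (R (K.starProjection z))‖ ≤ δ * ‖z‖ :=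
  (K.starProjection - p⁻¹ • (K.starProjection ∘L R ∘L K.starProjection)).le_of_opNorm_le h z

theorem RestrictedIsometry.abs_inner_sub_le (h : RestrictedIsometry K R p δ) (hx : x ∈ K)
    (hy : y ∈ K) : |⟪x, y⟫_ℝ - p⁻¹ * ⟪x, R y⟫_ℝ| ≤ δ * ‖x‖ * ‖y‖ := by
  have compress : ⟪x, y⟫_ℝ - p⁻¹ * ⟪x, R y⟫_ℝ =
      ⟪x, K.starProjection y - p⁻¹ • K.starProjection (R (K.starProjection y))⟫_ℝ := by
    rw [inner_sub_right, inner_smul_right, ← K.inner_starProjection_left_eq_right x (R _),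
      Submodule.starProjection_eq_self_iff.2 hx, Submodule.starProjection_eq_self_iff.2 hy]
  calc _ ≤ ‖x‖ * ‖K.starProjection y - p⁻¹ • K.starProjection (R (K.starProjection y))‖ := by
        rw [compress]; exact abs_real_inner_le_norm _ _
    _ ≤ ‖x‖ * (δ * ‖y‖) := by gcongr; exact h.norm_apply_le y
    _ = δ * ‖x‖ * ‖y‖ := by ring

theorem RestrictedIsometry.le_inner_apply_self (h : RestrictedIsometry K R p δ) (hp : 0 < p)
    (hx : x ∈ K) : (1 - δ) * p * ‖x‖ ^ 2 ≤ ⟪x, R x⟫_ℝ := by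
  have deviation := (abs_le.1 (h.abs_inner_sub_le hx hx)).2
  rw [real_inner_self_eq_norm_sq] at deviation
  have : (1 - δ) * ‖x‖ ^ 2 ≤ p⁻¹ * ⟪x, R x⟫_ℝ := by linarith
  rw [inv_mul_eq_div, le_div_iff₀ hp] at this
  linarith

theorem RestrictedIsometry.inner_apply_self_le (h : RestrictedIsometry K R p δ) (hp : 0 < p)
    (hx : x ∈ K) : ⟪x, R x⟫_ℝ ≤ (1 + δ) * p * ‖x‖ ^ 2 := by
  have deviation := (abs_le.1 (h.abs_inner_sub_le hx hx)).1
  rw [real_inner_self_eq_norm_sq] at deviation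
  have : p⁻¹ * ⟪x, R x⟫_ℝ ≤ (1 + δ) * ‖x‖ ^ 2 := by linarith
  rw [inv_mul_eq_div, div_le_iff₀ hp] at this
  linarith

theorem RestrictedIsometry.norm_compression_le (h : RestrictedIsometry K R p δ) (z : E) :
    ‖p⁻¹ • K.starProjection (R (K.starProjection z))‖ ≤ (1 + δ) * ‖z‖ := by
  calc _ = ‖K.starProjection z -
        (K.starProjection z - p⁻¹ • K.starProjection (R (K.starProjection z)))‖ := by
        rw [sub_sub_cancel]
    _ ≤ ‖z‖ + δ * ‖z‖ := (norm_sub_le _ _).trans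
        (add_le_add (K.norm_starProjection_apply_le z) (h.norm_apply_le z))
    _ = (1 + δ) * ‖z‖ := by ring

theorem norm_apply_sq_le_of_isPositive (hR : R.IsPositive) (y : E) :
    ‖R y‖ ^ 2 ≤ ‖R‖ * ⟪y, R y⟫_ℝ := by
  rcases (norm_nonneg R).eq_or_lt with hzero | hpos
  · simp [norm_eq_zero.1 hzero.symm]
  have cross : ⟪y, R (R y)⟫_ℝ = ‖R y‖ ^ 2 := by
    rw [← hR.inner_left_eq_inner_right, real_inner_self_eq_norm_sq]
  have expand : 0 ≤ ⟪y, R y⟫_ℝ - 2 * ‖R‖⁻¹ * ‖R y‖ ^ 2 + ‖R‖⁻¹ ^ 2 * ⟪R y, R (R y)⟫_ℝ := by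
    have := hR.inner_nonneg_right (y - ‖R‖⁻¹ • R y)
    simp only [map_sub, map_smul, inner_sub_left, inner_sub_right, inner_smul_left,
      inner_smul_right, cross, real_inner_self_eq_norm_sq, conj_trivial] at this
    linarith
  have quadratic : ⟪R y, R (R y)⟫_ℝ ≤ ‖R‖ * ‖R y‖ ^ 2 := by
    calc _ ≤ ‖R y‖ * (‖R‖ * ‖R y‖) := (real_inner_le_norm _ _).trans
          (by gcongr; exact R.le_opNorm _)
      _ = ‖R‖ * ‖R y‖ ^ 2 := by ring
  have : ‖R‖⁻¹ * ‖R y‖ ^ 2 ≤ ⟪y, R y⟫_ℝ := by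
    have : ‖R‖⁻¹ ^ 2 * ⟪R y, R (R y)⟫_ℝ ≤ ‖R‖⁻¹ * ‖R y‖ ^ 2 := by
      calc _ ≤ ‖R‖⁻¹ ^ 2 * (‖R‖ * ‖R y‖ ^ 2) := by gcongr
        _ = ‖R‖⁻¹ * ‖R y‖ ^ 2 := by field_simp
    linarith
  rwa [inv_mul_le_iff₀ hpos] at this

theorem RestrictedIsometry.norm_comp_starProjection_le (h : RestrictedIsometry K R p δ)
    (hp : 0 < p) (hR : R.IsPositive) (hL : ‖R‖ ≤ L) :
    ‖R ∘L K.starProjection‖ ≤ √(L * (1 + δ) * p) := by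
  refine ContinuousLinearMap.opNorm_le_bound _ (Real.sqrt_nonneg _) fun z => ?_
  have hδ := h.nonneg
  have hL₀ : 0 ≤ L := (norm_nonneg R).trans hL
  have mem := K.starProjection_apply_mem z
  rw [← Real.sqrt_sq (norm_nonneg z), ← Real.sqrt_mul (by positivity)]
  refine Real.le_sqrt_of_sq_le ?_
  calc ‖R (K.starProjection z)‖ ^ 2
      ≤ ‖R‖ * ⟪K.starProjection z, R (K.starProjection z)⟫_ℝ := norm_apply_sq_le_of_isPositive hR _
    _ ≤ L * ((1 + δ) * p * ‖z‖ ^ 2) := by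
      gcongr
      · exact hR.inner_nonneg_right _
      · exact (h.inner_apply_self_le hp mem).trans (by
          gcongr; exact K.norm_starProjection_apply_le z)
    _ = L * (1 + δ) * p * ‖z‖ ^ 2 := by ring

theorem norm_starProjection_comp [CompleteSpace E] (hR : IsSelfAdjoint R) :
    ‖K.starProjection ∘L R‖ = ‖R ∘L K.starProjection‖ := by
  rw [← LinearIsometryEquiv.norm_map ContinuousLinearMap.adjoint (K.starProjection ∘L R),
    ContinuousLinearMap.adjoint_comp, hR.adjoint_eq,
    (isSelfAdjoint_starProjection K).adjoint_eq]

theorem norm_comp_starProjection_le_add (hL : ‖R‖ ≤ L)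
    (hD : ‖K.starProjection - K₀.starProjection‖ ≤ D) :
    ‖R ∘L K.starProjection‖ ≤ L * D + ‖R ∘L K₀.starProjection‖ := by
  calc _ = ‖R ∘L (K.starProjection - K₀.starProjection) + R ∘L K₀.starProjection‖ := by
        rw [ContinuousLinearMap.comp_sub, sub_add_cancel]
    _ ≤ ‖R‖ * ‖K.starProjection - K₀.starProjection‖ + ‖R ∘L K₀.starProjection‖ :=
        (norm_add_le _ _).trans (add_le_add_left (ContinuousLinearMap.opNorm_comp_le _ _) _)
    _ ≤ _ := by gcongr; exact (norm_nonneg R).trans hL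

theorem norm_compression_sub_le [CompleteSpace E] (hR : IsSelfAdjoint R) (hL : ‖R‖ ≤ L)
    (hD : ‖K.starProjection - K₀.starProjection‖ ≤ D) :
    ‖K₀.starProjection ∘L R ∘L K₀.starProjection - K.starProjection ∘L R ∘L K.starProjection‖ ≤
      L * D ^ 2 + 2 * (‖R ∘L K₀.starProjection‖ * D) := by
  set P := K.starProjection
  set P₀ := K₀.starProjection
  have hD₀ : 0 ≤ D := (norm_nonneg _).trans hD
  have split : P₀ ∘L R ∘L P₀ - P ∘L R ∘L P = -((P₀ ∘L R) ∘L (P - P₀) + (P - P₀) ∘L R ∘L P) := by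
    simp only [ContinuousLinearMap.comp_sub, ContinuousLinearMap.sub_comp,
      ContinuousLinearMap.comp_assoc]
    abel
  calc ‖P₀ ∘L R ∘L P₀ - P ∘L R ∘L P‖
      ≤ ‖P₀ ∘L R‖ * ‖P - P₀‖ + ‖P - P₀‖ * ‖R ∘L P‖ := by
        rw [split, norm_neg]
        exact (norm_add_le _ _).trans (add_le_add (ContinuousLinearMap.opNorm_comp_le _ _)
          (ContinuousLinearMap.opNorm_comp_le _ _))
    _ ≤ ‖R ∘L P₀‖ * D + D * (L * D + ‖R ∘L P₀‖) := by
        rw [norm_starProjection_comp hR]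
        gcongr
        exact norm_comp_starProjection_le_add hL hD
    _ = L * D ^ 2 + 2 * (‖R ∘L P₀‖ * D) := by ring

theorem inv_mul_sqrt_mul_le (hp : 0 < p) (hε : 0 ≤ ε) (hL : 1 ≤ L)
    (hD : D * (L * (1 + ε)) ≤ √p * ε) (hD₀ : 0 ≤ D) : p⁻¹ * (√(L * (1 + ε) * p) * D) ≤ ε := by
  rw [inv_mul_le_iff₀ hp, Real.sqrt_mul (by positivity)]
  calc √(L * (1 + ε)) * √p * D ≤ L * (1 + ε) * √p * D := by
        gcongr
        have one_le : 1 ≤ L * (1 + ε) := one_le_mul_of_one_le_of_one_le hL (by linarith)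
        exact (Real.sqrt_le_left (by positivity)).2 (le_self_pow₀ one_le two_ne_zero)
    _ = √p * (D * (L * (1 + ε))) := by ring
    _ ≤ √p * (√p * ε) := by gcongr
    _ = p * ε := by rw [← mul_assoc, Real.mul_self_sqrt hp.le]

theorem add_inv_mul_sq_le (hp : 0 < p) (hpL : p ≤ L) (hε : 0 ≤ ε) (hL : 1 ≤ L)
    (hD : D * (L * (1 + ε)) ≤ √p * ε) (hD₀ : 0 ≤ D) : D + p⁻¹ * (L * D ^ 2) ≤ ε := by
  have hL₀ : 0 < L := by linarith
  have linear : D ≤ ε / (1 + ε) := by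
    have sqrt_le : √p ≤ L :=
      (Real.sqrt_le_left hL₀.le).2 (hpL.trans (le_self_pow₀ hL two_ne_zero))
    rw [le_div_iff₀ (by positivity)]
    refine le_of_mul_le_mul_left ?_ hL₀
    calc L * (D * (1 + ε)) = D * (L * (1 + ε)) := by ring
      _ ≤ L * ε := hD.trans (by gcongr)
  have quadratic : p⁻¹ * (L * D ^ 2) ≤ (ε / (1 + ε)) ^ 2 := by
    rw [inv_mul_le_iff₀ hp, div_pow, mul_div_assoc', le_div_iff₀ (by positivity)]
    calc L * D ^ 2 * (1 + ε) ^ 2 ≤ L * (L * D ^ 2 * (1 + ε) ^ 2) :=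
          le_mul_of_one_le_left (by positivity) hL
      _ = (D * (L * (1 + ε))) ^ 2 := by ring
      _ ≤ (√p * ε) ^ 2 := by gcongr
      _ = p * ε ^ 2 := by rw [mul_pow, Real.sq_sqrt hp.le]
  calc D + p⁻¹ * (L * D ^ 2) ≤ ε / (1 + ε) + (ε / (1 + ε)) ^ 2 := add_le_add linear quadratic
    _ ≤ ε := by
      rw [div_pow, div_add_div _ _ (by positivity) (by positivity), div_le_iff₀ (by positivity)]
      have : 0 ≤ ε ^ 3 * (1 + ε) := by positivity
      nlinarith

theorem RestrictedIsometry.of_norm_sub_le [CompleteSpace E] (h : RestrictedIsometry K₀ R p ε)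
    (hR : R.IsPositive) (hp : 0 < p) (hpL : p ≤ L) (hL : 1 ≤ L) (hRL : ‖R‖ ≤ L)
    (hD : D * (L * (1 + ε)) ≤ √p * ε) (hK : ‖K.starProjection - K₀.starProjection‖ ≤ D) :
    RestrictedIsometry K R p (4 * ε) := by
  have hε := h.nonneg
  have hD₀ : 0 ≤ D := (norm_nonneg _).trans hK
  set P := K.starProjection
  set P₀ := K₀.starProjection
  have split : P - p⁻¹ • (P ∘L R ∘L P) = (P - P₀) + (P₀ - p⁻¹ • (P₀ ∘L R ∘L P₀)) +
      p⁻¹ • (P₀ ∘L R ∘L P₀ - P ∘L R ∘L P) := by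
    rw [smul_sub]; abel
  have change : ‖p⁻¹ • (P₀ ∘L R ∘L P₀ - P ∘L R ∘L P)‖ ≤
      p⁻¹ * (L * D ^ 2) + 2 * (p⁻¹ * (√(L * (1 + ε) * p) * D)) := by
    rw [norm_smul, Real.norm_of_nonneg (by positivity)]
    calc _ ≤ p⁻¹ * (L * D ^ 2 + 2 * (√(L * (1 + ε) * p) * D)) := by
          gcongr
          refine (norm_compression_sub_le hR.isSelfAdjoint hRL hK).trans ?_
          gcongr
          exact h.norm_comp_starProjection_le hp hR hRL
      _ = _ := by ring
  have small₁ := inv_mul_sqrt_mul_le hp hε hL hD hD₀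
  have small₂ := add_inv_mul_sq_le hp hpL hε hL hD hD₀
  calc ‖P - p⁻¹ • (P ∘L R ∘L P)‖ ≤ D + ε +
        (p⁻¹ * (L * D ^ 2) + 2 * (p⁻¹ * (√(L * (1 + ε) * p) * D))) := by
        rw [split]
        exact (norm_add₃_le).trans (add_le_add (add_le_add hK h) change)
    _ ≤ 4 * ε := by linarith

theorem RestrictedIsometry.isNearlyTangent [CompleteSpace E] (h : RestrictedIsometry K₀ R p ε)
    (hR : R.IsPositive) (hp : 0 < p) (hpL : p ≤ L) (hL : 1 ≤ L) (hRL : ‖R‖ ≤ L)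
    (hD : D * (L * (1 + ε)) ≤ √p * ε) (hK : ‖K.starProjection - K₀.starProjection‖ ≤ D)
    (hz : ‖z - K.starProjection z‖ ≤ D / 2 * ‖z‖) : IsNearlyTangent K R p ε z := by
  have hε := h.nonneg
  have hD₀ : 0 ≤ D := (norm_nonneg _).trans hK
  have small₁ := inv_mul_sqrt_mul_le hp hε hL hD hD₀
  have small₂ := add_inv_mul_sq_le hp hpL hε hL hD hD₀
  have cross : ‖K.starProjection ∘L R‖ ≤ L * D + √(L * (1 + ε) * p) := by
    rw [norm_starProjection_comp hR.isSelfAdjoint]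
    exact (norm_comp_starProjection_le_add hRL hK).trans
      (add_le_add_right (h.norm_comp_starProjection_le hp hR hRL) _)
  calc _ ≤ D / 2 * ‖z‖ + p⁻¹ * ((L * D + √(L * (1 + ε) * p)) * (D / 2 * ‖z‖)) := by
        gcongr
        exact (K.starProjection ∘L R).le_of_opNorm_le_of_le cross hz
    _ = (D + p⁻¹ * (L * D ^ 2) + p⁻¹ * (√(L * (1 + ε) * p) * D)) / 2 * ‖z‖ := by ring
    _ ≤ ε * ‖z‖ := by gcongr; linarith

end RestrictedIsometry

/-! ### One step of the conjugate gradient method -/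

section ConjugateGradient

variable {E : Type*} [NormedAddCommGroup E] [InnerProductSpace ℝ E] {R : E →L[ℝ] E}
  {K : Submodule ℝ E} [K.HasOrthogonalProjection] {p δ ε k₁ k₂ a b κ η : ℝ} {e g q Q : E}

/-- The relative deviation of the step size from the inverse sampling rate `p⁻¹`, for a restricted
isometry constant `δ`. -/
def stepsizeDev (k₁ δ : ℝ) : ℝ := δ / ((1 - δ) - k₁ * (1 + δ))

/-- The contraction factor of a step that follows the gradient, for a restricted isometry
constant `δ` and a relative normal error `ε`. -/
def gradientRate (k₁ δ ε : ℝ) : ℝ :=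
  δ + (1 + δ) * stepsizeDev k₁ δ + ε * (1 + stepsizeDev k₁ δ)

/-- The bound on the weight of the previous direction, for a restricted isometry constant `δ`. -/
def conjWeight (k₁ k₂ δ : ℝ) : ℝ := k₂ * (δ + k₁) / (1 - δ)

theorem stepsizeDev_nonneg (hδ : 0 ≤ δ) (hdev : 0 < (1 - δ) - k₁ * (1 + δ)) :
    0 ≤ stepsizeDev k₁ δ :=
  div_nonneg hδ hdev.le

theorem gradientRate_nonneg (hδ : 0 ≤ δ) (hε : 0 ≤ ε) (hdev : 0 < (1 - δ) - k₁ * (1 + δ)) :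
    0 ≤ gradientRate k₁ δ ε := by
  have := stepsizeDev_nonneg hδ hdev
  unfold gradientRate
  positivity

theorem conjWeight_nonneg (hδ : 0 ≤ δ) (hδ₁ : δ < 1) (hk₁ : 0 ≤ k₁) (hk₂ : 0 ≤ k₂) :
    0 ≤ conjWeight k₁ k₂ δ :=
  div_nonneg (by positivity) (sub_nonneg.2 hδ₁.le)

/-- The coefficient `b` of the previous direction `q` in the new direction `g + b • q`: it vanishes
after a restart, and otherwise makes the two directions `R`-conjugate. -/
def IsConjCoeff (R : E →L[ℝ] E) (k₁ k₂ : ℝ) (g q : E) (b : ℝ) : Prop :=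
  b = 0 ∨ KeepsDirection k₁ k₂ g q ∧ b = -(⟪g, R q⟫_ℝ / ⟪q, R q⟫_ℝ)

theorem KeepsDirection.abs_inner_le (h : KeepsDirection k₁ k₂ g q) :
    |⟪g, q⟫_ℝ| ≤ k₁ * (‖g‖ * ‖q‖) := by
  rcases (by positivity : 0 ≤ ‖g‖ * ‖q‖).eq_or_lt with hzero | hpos
  · rw [← hzero, mul_zero, hzero]
    exact abs_real_inner_le_norm g q
  · exact (div_le_iff₀ hpos).1 h.1

theorem KeepsDirection.abs_inner_apply_le (h : KeepsDirection k₁ k₂ g q)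
    (hiso : RestrictedIsometry K R p δ) (hp : 0 < p) (hk₁ : 0 ≤ k₁) (hg : g ∈ K) (hq : q ∈ K) :
    |⟪g, R q⟫_ℝ| ≤ p * (k₂ * (δ + k₁) * ‖q‖ ^ 2) := by
  have hδ := hiso.nonneg
  have scaled : |p⁻¹ * ⟪g, R q⟫_ℝ| ≤ k₂ * (δ + k₁) * ‖q‖ ^ 2 := by
    calc |p⁻¹ * ⟪g, R q⟫_ℝ| ≤ |⟪g, q⟫_ℝ - p⁻¹ * ⟪g, R q⟫_ℝ| + |⟪g, q⟫_ℝ| := by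
          simpa only [sub_sub_cancel_left, abs_neg] using
            (abs_sub (⟪g, q⟫_ℝ - p⁻¹ * ⟪g, R q⟫_ℝ) ⟪g, q⟫_ℝ)
      _ ≤ δ * ‖g‖ * ‖q‖ + k₁ * (‖g‖ * ‖q‖) :=
          add_le_add (hiso.abs_inner_sub_le hg hq) h.abs_inner_le
      _ = (δ + k₁) * (‖g‖ * ‖q‖) := by ring
      _ ≤ (δ + k₁) * (k₂ * ‖q‖ * ‖q‖) := by gcongr; exact h.2
      _ = k₂ * (δ + k₁) * ‖q‖ ^ 2 := by ring
  rwa [abs_mul, abs_of_pos (inv_pos.2 hp), inv_mul_le_iff₀ hp] at scaled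

theorem IsConjCoeff.abs_le (hb : IsConjCoeff R k₁ k₂ g q b) (hiso : RestrictedIsometry K R p δ)
    (hp : 0 < p) (hδ : δ < 1) (hk₁ : 0 ≤ k₁) (hk₂ : 0 ≤ k₂) (hg : g ∈ K) (hq : q ∈ K) :
    |b| ≤ conjWeight k₁ k₂ δ := by
  have hδ₀ := hiso.nonneg
  have hδ₁ : 0 < 1 - δ := by linarith
  have weight_nonneg := conjWeight_nonneg hδ₀ hδ hk₁ hk₂
  obtain rfl | ⟨hkeep, rfl⟩ := hb
  · rwa [abs_zero]
  rcases eq_or_ne q 0 with rfl | hq₀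
  · simpa using weight_nonneg
  have energy_le := hiso.le_inner_apply_self hp hq
  have energy_pos : 0 < ⟪q, R q⟫_ℝ := lt_of_lt_of_le (by positivity) energy_le
  rw [abs_neg, abs_div, abs_of_pos energy_pos, conjWeight, div_le_div_iff₀ energy_pos hδ₁]
  calc |⟪g, R q⟫_ℝ| * (1 - δ) ≤ p * (k₂ * (δ + k₁) * ‖q‖ ^ 2) * (1 - δ) := by
        gcongr
        exact hkeep.abs_inner_apply_le hiso hp hk₁ hg hq
    _ = k₂ * (δ + k₁) * ((1 - δ) * p * ‖q‖ ^ 2) := by ring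
    _ ≤ k₂ * (δ + k₁) * ⟪q, R q⟫_ℝ := by gcongr

theorem IsConjCoeff.le_norm_add_smul (hb : IsConjCoeff R k₁ k₂ g q b) (hk₁ : 0 ≤ k₁)
    (hk₁' : k₁ ≤ 1) : (1 - k₁) * ‖g‖ ≤ ‖g + b • q‖ := by
  obtain rfl | ⟨hkeep, -⟩ := hb
  · rw [zero_smul, add_zero]
    nlinarith [norm_nonneg g]
  have cross : -(|b| * (k₁ * (‖g‖ * ‖q‖))) ≤ b * ⟪g, q⟫_ℝ := by
    refine (neg_le_neg ?_).trans (neg_abs_le _)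
    rw [abs_mul]
    gcongr
    exact hkeep.abs_inner_le
  have slack : 0 ≤ k₁ * (1 - k₁) * ‖g‖ ^ 2 := by
    have : 0 ≤ 1 - k₁ := by linarith
    positivity
  refine le_of_sq_le_sq ?_ (norm_nonneg _)
  rw [norm_add_sq_real, inner_smul_right, norm_smul, Real.norm_eq_abs]
  nlinarith [sq_nonneg (k₁ * ‖g‖ - |b| * ‖q‖)]

theorem IsConjCoeff.inner_apply_self (hb : IsConjCoeff R k₁ k₂ g q b) :
    ⟪g + b • q, R (g + b • q)⟫_ℝ = ⟪g + b • q, R g⟫_ℝ := by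
  have conj : b * ⟪g + b • q, R q⟫_ℝ = 0 := by
    obtain rfl | ⟨-, hb⟩ := hb
    · rw [zero_mul]
    rw [inner_add_left, real_inner_smul_left]
    by_cases hzero : ⟪q, R q⟫_ℝ = 0
    · rw [hb, hzero, div_zero, neg_zero, zero_mul]
    · rw [hb]
      field_simp
      ring
  rw [map_add, map_smul, inner_add_right, inner_smul_right, conj, add_zero]

theorem RestrictedIsometry.abs_stepsize_mul_sub_one_le (hiso : RestrictedIsometry K R p δ)
    (hp : 0 < p) (hk₁ : 0 ≤ k₁) (hdev : 0 < (1 - δ) - k₁ * (1 + δ)) (hg : g ∈ K) (hQ : Q ∈ K)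
    (hgQ : (1 - k₁) * ‖g‖ ≤ ‖Q‖) (hconj : ⟪Q, R Q⟫_ℝ = ⟪Q, R g⟫_ℝ) (hQ₀ : Q ≠ 0) :
    |⟪g, Q⟫_ℝ / ⟪Q, R Q⟫_ℝ * p - 1| ≤ stepsizeDev k₁ δ := by
  have hδ₀ := hiso.nonneg
  have hkδ : 0 ≤ k₁ * δ := by positivity
  have hδ₁ : 0 < 1 - δ := by nlinarith
  have energy_le := hiso.le_inner_apply_self hp hQ
  have energy_pos : 0 < ⟪Q, R Q⟫_ℝ := lt_of_lt_of_le (by positivity) energy_le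
  have deviation := hiso.abs_inner_sub_le hQ hg
  rw [← hconj, real_inner_comm] at deviation
  have rewrite_dev : ⟪g, Q⟫_ℝ / ⟪Q, R Q⟫_ℝ * p - 1 =
      p * (⟪g, Q⟫_ℝ - p⁻¹ * ⟪Q, R Q⟫_ℝ) / ⟪Q, R Q⟫_ℝ := by
    field_simp
  rw [rewrite_dev, abs_div, abs_mul, abs_of_pos hp, abs_of_pos energy_pos, stepsizeDev,
    div_le_div_iff₀ energy_pos hdev]
  have hdev_le : (1 - δ) - k₁ * (1 + δ) ≤ (1 - δ) * (1 - k₁) := by linarith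
  calc _ ≤ p * (δ * ‖Q‖ * ‖g‖) * ((1 - δ) * (1 - k₁)) := by gcongr
    _ = δ * p * ‖Q‖ * (1 - δ) * ((1 - k₁) * ‖g‖) := by ring
    _ ≤ δ * p * ‖Q‖ * (1 - δ) * ‖Q‖ := by gcongr
    _ = δ * ((1 - δ) * p * ‖Q‖ ^ 2) := by ring
    _ ≤ δ * ⟪Q, R Q⟫_ℝ := by gcongr

-- For `Q = 0` the step size is the junk value `0`, but then every `a'` gives the same step.
theorem IsConjCoeff.exists_smul_eq_stepsize (hb : IsConjCoeff R k₁ k₂ g q b)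
    (hiso : RestrictedIsometry K R p δ) (hp : 0 < p) (hk₁ : 0 ≤ k₁)
    (hdev : 0 < (1 - δ) - k₁ * (1 + δ)) (hg : g ∈ K) (hq : q ∈ K) (hQ : Q = g + b • q) :
    ∃ a', (⟪g, Q⟫_ℝ / ⟪Q, R Q⟫_ℝ) • Q = a' • Q ∧ |a' * p - 1| ≤ stepsizeDev k₁ δ := by
  have hδ₀ := hiso.nonneg
  rcases eq_or_ne Q 0 with hzero | hQ₀
  · refine ⟨p⁻¹, by simp [hzero], ?_⟩
    rw [inv_mul_cancel₀ hp.ne', sub_self, abs_zero]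
    exact stepsizeDev_nonneg hδ₀ hdev
  have hk₁' : k₁ ≤ 1 := by nlinarith [mul_nonneg hk₁ hδ₀]
  subst hQ
  exact ⟨_, rfl, hiso.abs_stepsize_mul_sub_one_le hp hk₁ hdev hg
    (K.add_mem hg (K.smul_mem b hq)) (hb.le_norm_add_smul hk₁ hk₁') hb.inner_apply_self hQ₀⟩

theorem norm_gradient_le (hiso : RestrictedIsometry K R p δ) (hp : 0 < p)
    (hnormal : IsNearlyTangent K R p ε e) :
    p⁻¹ * ‖K.starProjection (R e)‖ ≤ (1 + δ + ε) * ‖e‖ := by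
  have split : p⁻¹ • K.starProjection (R e) =
      p⁻¹ • K.starProjection (R (K.starProjection e)) +
        p⁻¹ • K.starProjection (R (e - K.starProjection e)) := by
    rw [← smul_add, ← map_add, ← map_add, add_sub_cancel]
  rw [IsNearlyTangent, ← Real.norm_of_nonneg (inv_pos.2 hp).le, ← norm_smul] at hnormal
  rw [← Real.norm_of_nonneg (inv_pos.2 hp).le, ← norm_smul]
  rw [split]
  linarith [norm_add_le (p⁻¹ • K.starProjection (R (K.starProjection e)))
      (p⁻¹ • K.starProjection (R (e - K.starProjection e))),
    hiso.norm_compression_le e, norm_nonneg (e - K.starProjection e)]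

theorem abs_le_of_abs_mul_sub_one_le (hp : 0 < p) (ha : |a * p - 1| ≤ η) :
    |a| ≤ (1 + η) * p⁻¹ := by
  rw [← div_eq_mul_inv, le_div_iff₀ hp]
  calc |a| * p = |(a * p - 1) + 1| := by rw [sub_add_cancel, abs_mul, abs_of_pos hp]
    _ ≤ 1 + η := by linarith [abs_add_le (a * p - 1) 1, abs_one (α := ℝ)]

theorem norm_sub_smul_gradient_le (hiso : RestrictedIsometry K R p δ) (hp : 0 < p)
    (hnormal : IsNearlyTangent K R p ε e) (ha : |a * p - 1| ≤ η) :
    ‖e - a • K.starProjection (R e)‖ ≤ (δ + (1 + δ) * η + ε * (1 + η)) * ‖e‖ := by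
  have hη : 0 ≤ η := (abs_nonneg _).trans ha
  set P := K.starProjection
  have split : e - a • P (R e) = (e - P e) + (P e - p⁻¹ • P (R (P e))) +
      (1 - a * p) • p⁻¹ • P (R (P e)) - a • P (R (e - P e)) := by
    rw [map_sub, map_sub, smul_smul, sub_mul, one_mul, mul_assoc, mul_inv_cancel₀ hp.ne', mul_one]
    module
  have tangential : ‖(1 - a * p) • p⁻¹ • P (R (P e))‖ ≤ η * ((1 + δ) * ‖e‖) := by
    rw [norm_smul, Real.norm_eq_abs, abs_sub_comm]
    gcongr
    exact hiso.norm_compression_le e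
  have normal : ‖a • P (R (e - P e))‖ ≤ (1 + η) * (p⁻¹ * ‖P (R (e - P e))‖) := by
    rw [norm_smul, Real.norm_eq_abs, ← mul_assoc]
    gcongr
    exact abs_le_of_abs_mul_sub_one_le hp ha
  calc _ ≤ ‖e - P e‖ + δ * ‖e‖ + η * ((1 + δ) * ‖e‖) +
        (1 + η) * (p⁻¹ * ‖P (R (e - P e))‖) := by
        rw [split]
        exact (norm_sub_le _ _).trans (add_le_add (norm_add₃_le.trans
          (add_le_add (add_le_add_right (hiso.norm_apply_le e) _) tangential)) normal)
    _ ≤ (δ + (1 + δ) * η) * ‖e‖ +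
        (1 + η) * (‖e - P e‖ + p⁻¹ * ‖P (R (e - P e))‖) := by
        linarith [mul_nonneg hη (norm_nonneg (e - P e))]
    _ ≤ (δ + (1 + δ) * η) * ‖e‖ + (1 + η) * (ε * ‖e‖) := by gcongr; exact hnormal
    _ = _ := by ring

theorem norm_add_smul_direction_le (hiso : RestrictedIsometry K R p δ) (hp : 0 < p)
    (hnormal : IsNearlyTangent K R p ε e) (ha : |a * p - 1| ≤ η) (hb : |b| ≤ κ) :
    ‖e + a • (-K.starProjection (R e) + b • q)‖ ≤
      (δ + (1 + δ) * η + ε * (1 + η)) * ‖e‖ + κ * ((1 + η) * p⁻¹ * ‖q‖) := by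
  have split : e + a • (-K.starProjection (R e) + b • q) =
      (e - a • K.starProjection (R e)) + a • b • q := by module
  calc _ ≤ ‖e - a • K.starProjection (R e)‖ + ‖a • b • q‖ := split ▸ norm_add_le _ _
    _ ≤ (δ + (1 + δ) * η + ε * (1 + η)) * ‖e‖ + (1 + η) * p⁻¹ * (κ * ‖q‖) := by
        refine add_le_add (norm_sub_smul_gradient_le hiso hp hnormal ha) ?_
        have step := abs_le_of_abs_mul_sub_one_le hp ha
        rw [norm_smul, norm_smul, Real.norm_eq_abs, Real.norm_eq_abs]
        gcongr
        exact (abs_nonneg a).trans step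
    _ = _ := by ring

theorem norm_direction_le (hiso : RestrictedIsometry K R p δ) (hp : 0 < p)
    (hnormal : IsNearlyTangent K R p ε e) (hη : 0 ≤ η) (hb : |b| ≤ κ) :
    (1 + η) * p⁻¹ * ‖-K.starProjection (R e) + b • q‖ ≤
      (1 + (δ + (1 + δ) * η + ε * (1 + η))) * ‖e‖ + κ * ((1 + η) * p⁻¹ * ‖q‖) := by
  have gradient := norm_gradient_le hiso hp hnormal
  calc _ ≤ (1 + η) * p⁻¹ * (‖K.starProjection (R e)‖ + κ * ‖q‖) := by
        gcongr
        refine (norm_add_le _ _).trans ?_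
        rw [norm_neg, norm_smul, Real.norm_eq_abs]
        gcongr
    _ = (1 + η) * (p⁻¹ * ‖K.starProjection (R e)‖) + κ * ((1 + η) * p⁻¹ * ‖q‖) := by ring
    _ ≤ (1 + η) * ((1 + δ + ε) * ‖e‖) + κ * ((1 + η) * p⁻¹ * ‖q‖) := by gcongr
    _ = _ := by ring

end ConjugateGradient

/-! ### The rate of convergence -/

section Rate

open Filter Topology

variable {k₁ k₂ ε : ℝ}

theorem gamma₁_eq (h : 0 < (1 - 4 * ε) - k₁ * (1 + 4 * ε)) :
    gamma₁ k₁ k₂ ε = 2 * gradientRate k₁ (4 * ε) ε + conjWeight k₁ k₂ (4 * ε) := by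
  have rate : (18 * ε - 10 * k₁ * ε * (1 + 4 * ε)) / ((1 - 4 * ε) - k₁ * (1 + 4 * ε)) =
      2 * gradientRate k₁ (4 * ε) ε := by
    rw [gradientRate, stepsizeDev, div_eq_iff h.ne']
    generalize hD : (1 - 4 * ε) - k₁ * (1 + 4 * ε) = D at h
    field_simp
    rw [← hD]
    ring
  rw [gamma₁, rate, conjWeight]
  ring

theorem gamma₂_eq : gamma₂ k₁ k₂ ε = 2 * conjWeight k₁ k₂ (4 * ε) := by
  rw [gamma₂, conjWeight]
  ring

theorem vcg_sq (h : 0 ≤ gamma₂ k₁ k₂ ε) :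
    vcg k₁ k₂ ε ^ 2 = gamma₁ k₁ k₂ ε * vcg k₁ k₂ ε + gamma₂ k₁ k₂ ε := by
  have sq_sqrt := Real.sq_sqrt (by positivity : 0 ≤ gamma₁ k₁ k₂ ε ^ 2 + 4 * gamma₂ k₁ k₂ ε)
  rw [vcg]
  linear_combination sq_sqrt / 4

theorem gamma₁_le_vcg (h : 0 ≤ gamma₂ k₁ k₂ ε) : gamma₁ k₁ k₂ ε ≤ vcg k₁ k₂ ε := by
  have : gamma₁ k₁ k₂ ε ≤ √(gamma₁ k₁ k₂ ε ^ 2 + 4 * gamma₂ k₁ k₂ ε) :=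
    Real.le_sqrt_of_sq_le (by linarith)
  rw [vcg]
  linarith

theorem vcg_lt_one (h : 0 ≤ gamma₂ k₁ k₂ ε) (hlt : gamma₁ k₁ k₂ ε + gamma₂ k₁ k₂ ε < 1) :
    vcg k₁ k₂ ε < 1 := by
  have : √(gamma₁ k₁ k₂ ε ^ 2 + 4 * gamma₂ k₁ k₂ ε) < 2 - gamma₁ k₁ k₂ ε := by
    rw [Real.sqrt_lt' (by linarith)]
    nlinarith
  rw [vcg]
  linarith

theorem vcg_zero_zero (hε : 0 ≤ ε) (hε₁ : 4 * ε ≤ 1) : vcg 0 0 ε = 18 * ε / (1 - 4 * ε) := by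
  have h₁ : gamma₁ 0 0 ε = 18 * ε / (1 - 4 * ε) := by simp [gamma₁]
  have h₂ : gamma₂ 0 0 ε = 0 := by simp [gamma₂]
  have nonneg : 0 ≤ 18 * ε / (1 - 4 * ε) := div_nonneg (by linarith) (by linarith)
  rw [vcg, h₁, h₂, mul_zero, add_zero, Real.sqrt_sq nonneg, add_self_div_two]

-- `v` is the dominant root of the characteristic polynomial of the recursion.
theorem le_pow_mul_of_coupled_recursion {d s : ℕ → ℝ} {A κ v : ℝ} (hA : 0 ≤ A) (hκ : 0 ≤ κ)
    (hAv : A ≤ v) (hv : v ^ 2 = (A + κ) * v + 2 * κ) (hv₁ : v ≤ 1) (hd₀ : 0 ≤ d 0) (hs₀ : s 0 = 0)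
    (hd : ∀ l, d l ≤ d 0 → d (l + 1) ≤ A * d l + κ * s l)
    (hs : ∀ l, d l ≤ d 0 → s (l + 1) ≤ (2 + A) * d l + κ * s l) (l : ℕ) :
    d l ≤ v ^ l * d 0 := by
  have hv₀ : 0 ≤ v := hA.trans hAv
  suffices h : d l ≤ v ^ l * d 0 ∧ κ * s l ≤ (v - A) * (v ^ l * d 0) from h.1
  induction l with
  | zero =>
    refine ⟨by simp, ?_⟩
    rw [hs₀, mul_zero]
    exact mul_nonneg (sub_nonneg.2 hAv) (by positivity)
  | succ l ih =>
    obtain ⟨ihd, ihs⟩ := ih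
    have hle : d l ≤ d 0 := ihd.trans (mul_le_of_le_one_left hd₀ (pow_le_one₀ hv₀ hv₁))
    constructor
    · calc d (l + 1) ≤ A * d l + κ * s l := hd l hle
        _ ≤ A * (v ^ l * d 0) + (v - A) * (v ^ l * d 0) := by gcongr
        _ = v ^ (l + 1) * d 0 := by rw [pow_succ]; ring
    · calc κ * s (l + 1) ≤ κ * ((2 + A) * d l + κ * s l) := by gcongr; exact hs l hle
        _ ≤ κ * ((2 + A) * (v ^ l * d 0) + (v - A) * (v ^ l * d 0)) := by gcongr
        _ = (v - A) * (v ^ (l + 1) * d 0) := by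
          rw [pow_succ]; linear_combination -(v ^ l * d 0) * hv

theorem tendsto_gamma₁_add_gamma₂ (h : k₁ ≠ 1) :
    Tendsto (fun ε => gamma₁ k₁ k₂ ε + gamma₂ k₁ k₂ ε) (𝓝 0) (𝓝 (3 * k₁ * k₂)) := by
  have hk₁ : 1 - k₁ ≠ 0 := sub_ne_zero.2 h.symm
  have continuous : ContinuousAt (fun ε => gamma₁ k₁ k₂ ε + gamma₂ k₁ k₂ ε) 0 := by
    unfold gamma₁ gamma₂
    fun_prop (disch := simp [hk₁])
  have value : gamma₁ k₁ k₂ 0 + gamma₂ k₁ k₂ 0 = 3 * k₁ * k₂ := by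
    simp [gamma₁, gamma₂]; ring
  exact value ▸ continuous.tendsto

theorem gamma₁_one (hε : ε ≠ 0) :
    gamma₁ 1 k₂ ε = -(1 - 5 * ε) + (4 * k₂ * ε + k₂) / (1 - 4 * ε) := by
  have denominator : (1 - 4 * ε) - 1 * (1 + 4 * ε) = -8 * ε := by ring
  rw [gamma₁, denominator, one_mul]
  congr 1
  field_simp
  ring

theorem eventually_gamma₁_add_gamma₂_lt_one (h : k₁ * k₂ < 1 / 3) :
    ∀ᶠ ε in 𝓝[>] 0, gamma₁ k₁ k₂ ε + gamma₂ k₁ k₂ ε < 1 := by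
  rcases eq_or_ne k₁ 1 with rfl | hk₁
  · have continuous : ContinuousAt (fun ε : ℝ =>
        -(1 - 5 * ε) + (4 * k₂ * ε + k₂) / (1 - 4 * ε) + gamma₂ 1 k₂ ε) 0 := by
      unfold gamma₂
      fun_prop (disch := simp)
    have eventually_lt : ∀ᶠ ε : ℝ in 𝓝[>] 0,
        -(1 - 5 * ε) + (4 * k₂ * ε + k₂) / (1 - 4 * ε) + gamma₂ 1 k₂ ε < 1 :=
      (continuous.tendsto.mono_left nhdsWithin_le_nhds).eventually_lt_const
        (by simp [gamma₂]; linarith)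
    filter_upwards [eventually_lt, self_mem_nhdsWithin] with ε hlt hε
    rwa [gamma₁_one (Set.mem_Ioi.1 hε).ne']
  · exact ((tendsto_gamma₁_add_gamma₂ hk₁).mono_left nhdsWithin_le_nhds).eventually_lt_const
      (by linarith)

theorem gamma₁_add_gamma₂_lt_one_of_le (hε : 0 ≤ ε) (hε₁ : ε ≤ 0.01) :
    gamma₁ 0.1 1 ε + gamma₂ 0.1 1 ε < 1 := by
  norm_num at hε₁
  have h₁ : (18 * ε - 10 * 0.1 * ε * (1 + 4 * ε)) / ((1 - 4 * ε) - 0.1 * (1 + 4 * ε)) ≤ 0.3 := by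
    rw [div_le_iff₀ (by linarith)]
    nlinarith
  have h₂ : (4 * 1 * ε + 0.1 * 1) / (1 - 4 * ε) ≤ 0.2 := by
    rw [div_le_iff₀ (by linarith)]
    linarith
  have h₃ : (8 * 1 * ε + 2 * 0.1 * 1) / (1 - 4 * ε) ≤ 0.4 := by
    rw [div_le_iff₀ (by linarith)]
    linarith
  rw [gamma₁, gamma₂]
  linarith

end Rate

/-! ### The gap between subspaces of equal dimension -/

section Gap

variable {E F : Type*} [NormedAddCommGroup E] [InnerProductSpace ℝ E]
  [NormedAddCommGroup F] [InnerProductSpace ℝ F] {K K' : Submodule ℝ E} {c σ : ℝ} {x y : E}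

theorem norm_sub_starProjection_sq [K.HasOrthogonalProjection] (x : E) :
    ‖x - K.starProjection x‖ ^ 2 = ‖x‖ ^ 2 - ‖K.starProjection x‖ ^ 2 := by
  rw [Submodule.norm_sq_eq_add_norm_sq_starProjection x K, K.starProjection_orthogonal_val]
  ring

theorem norm_sub_starProjection_le [K.HasOrthogonalProjection] (hy : y ∈ K) (x : E) :
    ‖x - K.starProjection x‖ ≤ ‖x - y‖ := by
  rw [K.starProjection_minimal]
  exact ciInf_le ⟨0, Set.forall_mem_range.2 fun _ => norm_nonneg _⟩ (⟨y, hy⟩ : K)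

theorem norm_sub_starProjection_le_of_orthogonal [K.HasOrthogonalProjection]
    [K'.HasOrthogonalProjection] (hc : 0 ≤ c) (h : ∀ z ∈ K'ᗮ, ‖K.starProjection z‖ ≤ c * ‖z‖)
    (hx : x ∈ K) : ‖x - K'.starProjection x‖ ≤ c * ‖x‖ := by
  set z := x - K'.starProjection x
  have z_mem : z ∈ K'ᗮ := K'.sub_starProjection_mem_orthogonal x
  have sq_eq : ‖z‖ * ‖z‖ = ⟪x, K.starProjection z⟫_ℝ := by
    rw [← K.inner_starProjection_left_eq_right, Submodule.starProjection_eq_self_iff.2 hx,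
      ← real_inner_self_eq_norm_mul_norm, inner_sub_left,
      Submodule.inner_right_of_mem_orthogonal (K'.starProjection_apply_mem x) z_mem, sub_zero]
  rcases (norm_nonneg z).eq_or_lt' with hz | hz
  · rw [hz]
    positivity
  · refine le_of_mul_le_mul_left ?_ hz
    calc ‖z‖ * ‖z‖ ≤ ‖x‖ * ‖K.starProjection z‖ := sq_eq ▸ real_inner_le_norm _ _
      _ ≤ ‖x‖ * (c * ‖z‖) := by gcongr; exact h z z_mem
      _ = ‖z‖ * (c * ‖x‖) := by ring

theorem exists_mem_starProjection_eq [FiniteDimensional ℝ K] [FiniteDimensional ℝ K']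
    (hrank : Module.finrank ℝ K = Module.finrank ℝ K') (hc : c < 1)
    (h : ∀ x ∈ K, ‖x - K'.starProjection x‖ ≤ c * ‖x‖) (hy : y ∈ K') :
    ∃ x ∈ K, K'.starProjection x = y := by
  let f : K →ₗ[ℝ] K' := (K'.orthogonalProjectionOnto : E →ₗ[ℝ] K') ∘ₗ K.subtype
  have injective : Function.Injective f := by
    refine (injective_iff_map_eq_zero f).2 fun x hfx => ?_
    have : K'.starProjection (x : E) = 0 := congrArg Subtype.val hfx
    have contraction := h x x.2
    rw [this, sub_zero] at contraction
    have : ‖(x : E)‖ = 0 := by nlinarith [norm_nonneg (x : E)]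
    exact Subtype.ext (norm_eq_zero.1 this)
  obtain ⟨x, hx⟩ :=
    (LinearMap.injective_iff_surjective_of_finrank_eq_finrank hrank).1 injective ⟨y, hy⟩
  exact ⟨x, x.2, congrArg Subtype.val hx⟩

theorem norm_sub_starProjection_le_symm [FiniteDimensional ℝ K] [FiniteDimensional ℝ K']
    (hrank : Module.finrank ℝ K = Module.finrank ℝ K') (hc : 0 ≤ c)
    (h : ∀ x ∈ K, ‖x - K'.starProjection x‖ ≤ c * ‖x‖) (hy : y ∈ K') :
    ‖y - K.starProjection y‖ ≤ c * ‖y‖ := by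
  rcases le_or_gt 1 c with hc₁ | hc₁
  · calc _ ≤ ‖y - 0‖ := norm_sub_starProjection_le K.zero_mem y
      _ ≤ c * ‖y‖ := by rw [sub_zero]; exact le_mul_of_one_le_left (norm_nonneg y) hc₁
  obtain ⟨x, hx, rfl⟩ := exists_mem_starProjection_eq hrank hc₁ h hy
  rcases eq_or_ne x 0 with rfl | hx₀
  · simp
  set y := K'.starProjection x with y_def
  -- `t • x` is the point of the line through `x` closest to `y`
  set t := ‖y‖ ^ 2 / ‖x‖ ^ 2
  have t_mul : t * ‖x‖ ^ 2 = ‖y‖ ^ 2 := div_mul_cancel₀ _ (by positivity)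
  have inner_eq : ⟪y, x⟫_ℝ = ‖y‖ ^ 2 := by
    rw [← real_inner_self_eq_norm_sq, y_def, K'.inner_starProjection_left_eq_right,
      K'.inner_starProjection_left_eq_right, ← y_def, Submodule.starProjection_eq_self_iff.2 hy,
      real_inner_comm]
  refine le_of_sq_le_sq ?_ (by positivity)
  calc ‖y - K.starProjection y‖ ^ 2 ≤ ‖y - t • x‖ ^ 2 := by
        gcongr; exact norm_sub_starProjection_le (K.smul_mem t hx) y
    _ = t * (‖x‖ ^ 2 - ‖y‖ ^ 2) := by
        rw [norm_sub_sq_real, inner_smul_right, inner_eq, norm_smul, mul_pow, Real.norm_eq_abs,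
          sq_abs]
        linear_combination (t - 1) * t_mul
    _ ≤ t * (c * ‖x‖) ^ 2 := by
        rw [← norm_sub_starProjection_sq]
        gcongr
        exact h x hx
    _ = (c * ‖y‖) ^ 2 := by linear_combination c ^ 2 * t_mul

theorem norm_starProjection_sub_starProjection_le [FiniteDimensional ℝ K] [FiniteDimensional ℝ K']
    (hrank : Module.finrank ℝ K = Module.finrank ℝ K') (hc : 0 ≤ c)
    (h : ∀ z ∈ K'ᗮ, ‖K.starProjection z‖ ≤ c * ‖z‖) :
    ‖K.starProjection - K'.starProjection‖ ≤ c := by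
  refine ContinuousLinearMap.opNorm_le_bound _ hc fun x => ?_
  set x' := K'.starProjection x with x'_def
  have on_normal : ‖K.starProjection (x - x')‖ ≤ c * ‖x - x'‖ :=
    h _ (K'.sub_starProjection_mem_orthogonal x)
  have on_tangent : ‖x' - K.starProjection x'‖ ≤ c * ‖x'‖ :=
    norm_sub_starProjection_le_symm hrank hc
      (fun _ => norm_sub_starProjection_le_of_orthogonal hc h) (K'.starProjection_apply_mem x)
  have orthogonal : ⟪K.starProjection (x - x'), x' - K.starProjection x'⟫_ℝ = 0 :=
    Submodule.inner_right_of_mem_orthogonal (K.starProjection_apply_mem _)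
      (K.sub_starProjection_mem_orthogonal x')
  refine le_of_sq_le_sq ?_ (by positivity)
  calc ‖(K.starProjection - K'.starProjection) x‖ ^ 2 =
        ‖K.starProjection (x - x') - (x' - K.starProjection x')‖ ^ 2 := by
        congr 2; rw [map_sub, sub_apply, ← x'_def]; abel
    _ = ‖K.starProjection (x - x')‖ ^ 2 + ‖x' - K.starProjection x'‖ ^ 2 := by
        rw [norm_sub_sq_real, orthogonal]; ring
    _ ≤ (c * ‖x - x'‖) ^ 2 + (c * ‖x'‖) ^ 2 := by gcongr
    _ = (c * ‖x‖) ^ 2 := by rw [mul_pow, mul_pow, norm_sub_starProjection_sq]; ring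

/-- Wedin's bound: `z` orthogonal to `K'` satisfies
`σ ‖P z‖ ≤ ‖T† (P z)‖ = ‖T† z‖ = ‖(T - T')† z‖`, where `P` projects onto the range of `T`. -/
theorem norm_starProjection_range_sub_le [FiniteDimensional ℝ E] [FiniteDimensional ℝ F]
    {T T' : F →L[ℝ] E} (hrank : Module.finrank ℝ T.range = Module.finrank ℝ K')
    (hT' : T'.range ≤ K') (hσ : 0 < σ) (hT : ∀ u, σ * ‖T u‖ ≤ ‖T.adjoint (T u)‖) :
    ‖T.range.starProjection - K'.starProjection‖ ≤ ‖T - T'‖ / σ := by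
  refine norm_starProjection_sub_starProjection_le hrank (by positivity) fun z hz => ?_
  have adjoint_projection : T.adjoint (T.range.starProjection z) = T.adjoint z := by
    have : z - T.range.starProjection z ∈ T.adjoint.ker :=
      T.orthogonal_range ▸ T.range.sub_starProjection_mem_orthogonal z
    rw [LinearMap.mem_ker, ContinuousLinearMap.coe_coe, map_sub, sub_eq_zero] at this
    exact this.symm
  have adjoint_zero : T'.adjoint z = 0 := by
    have : z ∈ T'.rangeᗮ := Submodule.orthogonal_le hT' hz
    rwa [T'.orthogonal_range] at this
  obtain ⟨u, hu⟩ : T.range.starProjection z ∈ T.range := T.range.starProjection_apply_mem z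
  rw [ContinuousLinearMap.coe_coe] at hu
  rw [div_mul_eq_mul_div, le_div_iff₀' hσ]
  calc σ * ‖T.range.starProjection z‖ ≤ ‖T.adjoint (T.range.starProjection z)‖ := by
        rw [← hu]; exact hT u
    _ = ‖(T - T').adjoint z‖ := by
        rw [adjoint_projection, map_sub, sub_apply, adjoint_zero, sub_zero]
    _ ≤ ‖(T - T').adjoint‖ * ‖z‖ := ContinuousLinearMap.le_opNorm _ z
    _ = ‖T - T'‖ * ‖z‖ := by rw [LinearIsometryEquiv.norm_map]

end Gap

section Sup

variable {E : Type*} [NormedAddCommGroup E] [InnerProductSpace ℝ E] [FiniteDimensional ℝ E]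
  {A A' B B' : Submodule ℝ E} {x y : E}

theorem starProjection_sup (h : Commute A.starProjection B.starProjection) :
    (A ⊔ B).starProjection =
      A.starProjection + B.starProjection - A.starProjection * B.starProjection := by
  ext v
  refine Submodule.eq_starProjection_of_mem_orthogonal ?_ ?_
  · exact Submodule.sub_mem _
      (Submodule.add_mem_sup (A.starProjection_apply_mem v) (B.starProjection_apply_mem v))
      (Submodule.mem_sup_left (A.starProjection_apply_mem _))
  rw [← Submodule.inf_orthogonal]
  refine ⟨SetLike.mem_coe.2 ?_, SetLike.mem_coe.2 ?_⟩
  · convert A.sub_starProjection_mem_orthogonal (v - B.starProjection v) using 1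
    simp only [add_apply, sub_apply, mul_apply_eq_comp, map_sub]
    abel
  · rw [h.eq]
    convert B.sub_starProjection_mem_orthogonal (v - A.starProjection v) using 1
    simp only [add_apply, sub_apply, mul_apply_eq_comp, map_sub]
    abel

theorem one_sub_starProjection_sup (h : Commute A.starProjection B.starProjection) :
    1 - (A ⊔ B).starProjection = (1 - B.starProjection) * (1 - A.starProjection) := by
  rw [starProjection_sup h, h.eq]
  noncomm_ring

theorem norm_one_sub_starProjection_le : ‖1 - A.starProjection‖ ≤ 1 :=
  (isStarProjection_starProjection (U := A)).one_sub.norm_le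

theorem norm_starProjection_sup_sub_le (h : Commute A.starProjection B.starProjection)
    (h' : Commute A'.starProjection B'.starProjection) :
    ‖(A ⊔ B).starProjection - (A' ⊔ B').starProjection‖ ≤
      ‖A.starProjection - A'.starProjection‖ + ‖B.starProjection - B'.starProjection‖ := by
  have telescope : (A ⊔ B).starProjection - (A' ⊔ B').starProjection =
      (1 - B'.starProjection) * (A.starProjection - A'.starProjection) +
        (B.starProjection - B'.starProjection) * (1 - A.starProjection) := by
    rw [← sub_sub_sub_cancel_left _ _ 1, one_sub_starProjection_sup h,
      one_sub_starProjection_sup h']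
    noncomm_ring
  rw [telescope]
  refine (norm_add_le _ _).trans (add_le_add ?_ ?_)
  · exact (norm_mul_le _ _).trans
      (mul_le_of_le_one_left (norm_nonneg _) norm_one_sub_starProjection_le)
  · exact (norm_mul_le _ _).trans
      (mul_le_of_le_one_right (norm_nonneg _) norm_one_sub_starProjection_le)

theorem norm_sub_starProjection_sup_le (h : Commute A'.starProjection B'.starProjection)
    (h' : Commute A.starProjection B'.starProjection) (hx : x ∈ A) (hy : y ∈ B') :
    ‖(x - y) - (A' ⊔ B').starProjection (x - y)‖ ≤
      ‖A.starProjection - A'.starProjection‖ * ‖x - y‖ := by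
  have annihilated : (1 - B'.starProjection) (y - A.starProjection y) = 0 := by
    have := DFunLike.congr_fun h'.eq y
    simp only [mul_apply_eq_comp, Submodule.starProjection_eq_self_iff.2 hy] at this
    simp only [sub_apply, one_apply_eq_self, map_sub,
      Submodule.starProjection_eq_self_iff.2 hy, ← this, sub_self]
  have normal_eq : (x - y) - (A' ⊔ B').starProjection (x - y) =
      (1 - B'.starProjection) ((A.starProjection - A'.starProjection) (x - y)) := by
    have split : (1 - A'.starProjection) (x - y) =
        (A.starProjection - A'.starProjection) (x - y) - (y - A.starProjection y) := by
      simp only [sub_apply, one_apply_eq_self, map_sub,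
        Submodule.starProjection_eq_self_iff.2 hx]
      abel
    calc _ = (1 - (A' ⊔ B').starProjection) (x - y) := rfl
      _ = _ := by
        rw [one_sub_starProjection_sup h, mul_apply_eq_comp, split, map_sub,
          annihilated, sub_zero]
  rw [normal_eq]
  calc _ ≤ 1 * ‖(A.starProjection - A'.starProjection) (x - y)‖ :=
        (1 - B'.starProjection).le_of_opNorm_le norm_one_sub_starProjection_le _
    _ ≤ _ := by rw [one_mul]; exact ContinuousLinearMap.le_opNorm _ _

end Sup

/-! ### The smallest nonzero singular value -/

section MinSingularValue

variable {E F : Type*} [NormedAddCommGroup E] [InnerProductSpace ℝ E] [FiniteDimensional ℝ E]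
  [NormedAddCommGroup F] [InnerProductSpace ℝ F] [FiniteDimensional ℝ F]

/-- The smallest nonzero singular value of a linear map. It is `0` for the zero map, where the
infimum is over the empty set. -/
def minSingularValue (T : E →ₗ[ℝ] F) : ℝ :=
  sInf {s : ℝ | 0 < s ∧ ∃ i : ℕ, T.singularValues i = s}

theorem minSingularValue_pos {T : E →ₗ[ℝ] F} (hT : T ≠ 0) : 0 < minSingularValue T := by
  have finite : {s : ℝ | 0 < s ∧ ∃ i : ℕ, T.singularValues i = s}.Finite := by
    refine (T.singularValues.support.image T.singularValues).finite_toSet.subset ?_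
    rintro _ ⟨hs, i, rfl⟩
    exact Finset.mem_coe.2 (Finset.mem_image_of_mem _ (Finsupp.mem_support_iff.2 hs.ne'))
  have nonempty : {s : ℝ | 0 < s ∧ ∃ i : ℕ, T.singularValues i = s}.Nonempty := by
    obtain ⟨i, hi⟩ := Finsupp.ne_iff.1 (T.singularValues_eq_zero_iff.not.2 hT)
    exact ⟨_, (T.singularValues_pos_iff_ne_zero i).2 hi, i, rfl⟩
  exact (nonempty.csInf_mem finite).1

theorem minSingularValue_nonneg (T : E →ₗ[ℝ] F) : 0 ≤ minSingularValue T :=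
  Real.sInf_nonneg fun _ hs => hs.1.le

theorem minSingularValue_le {T : E →ₗ[ℝ] F} {i : ℕ} (hi : 0 < T.singularValues i) :
    minSingularValue T ≤ T.singularValues i :=
  csInf_le ⟨0, fun _ hs => hs.1.le⟩ ⟨hi, i, rfl⟩

theorem norm_apply_sq_eq_sum_singularValues (T : E →ₗ[ℝ] F) (x : E) :
    ‖T x‖ ^ 2 = ∑ i : Fin (Module.finrank ℝ E), T.singularValues i ^ 2 *
      ⟪T.isSymmetric_adjoint_comp_self.eigenvectorBasis rfl i, x⟫_ℝ ^ 2 := by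
  have symmetric := T.isSymmetric_adjoint_comp_self
  set e := symmetric.eigenvectorBasis rfl
  have eigen (i) : ⟪e i, (T.adjoint ∘ₗ T) x⟫_ℝ = T.singularValues i ^ 2 * ⟪e i, x⟫_ℝ := by
    rw [← symmetric, symmetric.apply_eigenvectorBasis, T.sq_singularValues_fin rfl,
      inner_smul_left]
    rfl
  calc ‖T x‖ ^ 2 = ⟪x, (T.adjoint ∘ₗ T) x⟫_ℝ := by
        rw [LinearMap.comp_apply, LinearMap.adjoint_inner_right, real_inner_self_eq_norm_sq]
    _ = _ := by
        rw [← e.sum_inner_mul_inner]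
        refine Finset.sum_congr rfl fun i _ => ?_
        rw [eigen, real_inner_comm]
        ring

theorem minSingularValue_mul_norm_le (T : E →ₗ[ℝ] F) {x : E} (hx : x ∈ T.kerᗮ) :
    minSingularValue T * ‖x‖ ≤ ‖T x‖ := by
  set e := T.isSymmetric_adjoint_comp_self.eigenvectorBasis rfl with e_def
  refine le_of_sq_le_sq ?_ (norm_nonneg _)
  rw [mul_pow, norm_apply_sq_eq_sum_singularValues, ← e_def, ← e.sum_sq_inner_right,
    Finset.mul_sum]
  refine Finset.sum_le_sum fun i _ => ?_
  rcases (T.singularValues_nonneg i).eq_or_lt' with zero | pos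
  · have apply_eq_zero : T (e i) = 0 := by
      have : ‖T (e i)‖ ^ 2 = 0 := by
        rw [norm_apply_sq_eq_sum_singularValues, ← e_def]
        refine Finset.sum_eq_zero fun j _ => ?_
        rw [e.inner_eq_ite]
        split_ifs with hji <;> simp [*]
      simpa using this
    rw [Submodule.inner_right_of_mem_orthogonal (LinearMap.mem_ker.2 apply_eq_zero) hx]
    simp
  · gcongr
    exacts [minSingularValue_nonneg T, minSingularValue_le pos]

theorem minSingularValue_mul_norm_adjoint_le (T : E →ₗ[ℝ] F) (u : F) :
    minSingularValue T * ‖T.adjoint u‖ ≤ ‖T (T.adjoint u)‖ :=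
  minSingularValue_mul_norm_le T (T.orthogonal_ker ▸ LinearMap.mem_range_self _ u)

theorem minSingularValue_mul_norm_apply_le (T : E →ₗ[ℝ] F) (u : E) :
    minSingularValue T * ‖T u‖ ≤ ‖T.adjoint (T u)‖ := by
  set v := T.kerᗮ.starProjection u
  have apply_eq : T v = T u := by
    have : u - v ∈ T.ker := by
      rw [← T.ker.orthogonal_orthogonal]
      exact T.kerᗮ.sub_starProjection_mem_orthogonal u
    rw [LinearMap.mem_ker, map_sub, sub_eq_zero] at this
    exact this.symm
  rw [← apply_eq]
  rcases (norm_nonneg (T v)).eq_or_lt' with hv | hv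
  · rw [hv, mul_zero]
    exact norm_nonneg _
  refine le_of_mul_le_mul_left ?_ hv
  calc ‖T v‖ * (minSingularValue T * ‖T v‖) = minSingularValue T * ⟪v, T.adjoint (T v)⟫_ℝ := by
        rw [LinearMap.adjoint_inner_right, real_inner_self_eq_norm_mul_norm]
        ring
    _ ≤ minSingularValue T * (‖v‖ * ‖T.adjoint (T v)‖) := by
        gcongr
        exacts [minSingularValue_nonneg T, real_inner_le_norm _ _]
    _ = (minSingularValue T * ‖v‖) * ‖T.adjoint (T v)‖ := by ring
    _ ≤ ‖T v‖ * ‖T.adjoint (T v)‖ := by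
        gcongr
        exact minSingularValue_mul_norm_le T (T.kerᗮ.starProjection_apply_mem u)

end MinSingularValue

/-! ### The tensor algebra in the transform domain -/

section FrobSq

open Matrix

variable {l m n : Type*} [Fintype l] [Fintype m] [Fintype n]

/-- The squared Frobenius norm of a matrix. -/
def frobSq (M : Matrix m n ℝ) : ℝ := (Mᵀ * M).trace

theorem frobSq_eq_sum (M : Matrix m n ℝ) : frobSq M = ∑ i, ∑ j, M i j ^ 2 := by
  simp only [frobSq, trace, diag_apply, mul_apply, transpose_apply, ← pow_two]
  exact Finset.sum_comm

theorem frobSq_nonneg (M : Matrix m n ℝ) : 0 ≤ frobSq M := by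
  rw [frobSq_eq_sum]
  positivity

theorem frobSq_transpose (M : Matrix m n ℝ) : frobSq Mᵀ = frobSq M := by
  rw [frobSq, frobSq, transpose_transpose, trace_mul_comm]

theorem frobSq_mul_le (M : Matrix l m ℝ) (N : Matrix m n ℝ) :
    frobSq (M * N) ≤ frobSq M * frobSq N := by
  rw [← frobSq_transpose N, frobSq_eq_sum, frobSq_eq_sum M, frobSq_eq_sum Nᵀ,
    Finset.sum_mul_sum]
  exact Finset.sum_le_sum fun i _ => Finset.sum_le_sum fun j _ =>
    Finset.sum_mul_sq_le_sq_mul_sq _ _ _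

end FrobSq

section Slices

open Matrix

variable {a b c d e : ℕ}

/-- The `k`-th frontal slice in the transform domain, the paper's `Â⁽ᵏ⁾`. -/
def hat (A : Tensor a b c) (k : Fin c) : Matrix (Fin a) (Fin b) ℝ := slice (dct A) k

theorem hat_ext {A B : Tensor a b c} (h : ∀ k, hat A k = hat B k) : A = B := by
  rw [← idct_dct A, ← idct_dct B]
  congr 1
  ext ⟨i, j, k⟩
  exact congrFun (congrFun (h k) i) j

theorem hat_idct (A : Tensor a b c) (k : Fin c) : hat (idct A) k = slice A k := by
  rw [hat, dct_idct]

theorem hat_idct_fold (M : Matrix (Fin a × Fin c) (Fin b × Fin c) ℝ) (k : Fin c) :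
    hat (idct (fold M)) k = blockDiag M k :=
  hat_idct _ k

theorem hat_tprod (A : Tensor a b c) (B : Tensor b d c) (k : Fin c) :
    hat (A ∗ₜ B) k = hat A k * hat B k := by
  rw [tprod, hat_idct_fold, bdiag, bdiag, ← blockDiagonal_mul, blockDiag_blockDiagonal]
  rfl

theorem hat_tr (A : Tensor a b c) (k : Fin c) : hat (tr A) k = (hat A k)ᵀ := by
  rw [tr, hat_idct_fold, bdiag, blockDiagonal_transpose, blockDiag_blockDiagonal]
  rfl

theorem hat_add (A B : Tensor a b c) (k : Fin c) : hat (A + B) k = hat A k + hat B k := by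
  rw [hat, dct_add]; rfl

theorem hat_smul (t : ℝ) (A : Tensor a b c) (k : Fin c) : hat (t • A) k = t • hat A k := by
  rw [hat, dct_smul]; rfl

theorem hat_zero (k : Fin c) : hat (0 : Tensor a b c) k = 0 := by
  rw [← zero_smul ℝ (0 : Tensor a b c), hat_smul, zero_smul]

theorem hat_sub (A B : Tensor a b c) (k : Fin c) : hat (A - B) k = hat A k - hat B k := by
  rw [sub_eq_add_neg, ← neg_one_smul ℝ B, hat_add, hat_smul, neg_one_smul, ← sub_eq_add_neg]

theorem tprod_assoc (A : Tensor a b c) (B : Tensor b d c) (C : Tensor d e c) :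
    A ∗ₜ B ∗ₜ C = A ∗ₜ (B ∗ₜ C) :=
  hat_ext fun k => by simp only [hat_tprod, Matrix.mul_assoc]

theorem tr_tr (A : Tensor a b c) : tr (tr A) = A :=
  hat_ext fun k => by simp only [hat_tr, transpose_transpose]

theorem tr_tprod (A : Tensor a b c) (B : Tensor b d c) : tr (A ∗ₜ B) = tr B ∗ₜ tr A :=
  hat_ext fun k => by simp only [hat_tr, hat_tprod, transpose_mul]

theorem tr_sub (A B : Tensor a b c) : tr (A - B) = tr A - tr B :=
  hat_ext fun k => by simp only [hat_tr, hat_sub, transpose_sub]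

theorem tprod_sub (A : Tensor a b c) (B B' : Tensor b d c) :
    A ∗ₜ (B - B') = A ∗ₜ B - A ∗ₜ B' :=
  hat_ext fun k => by simp only [hat_tprod, hat_sub, Matrix.mul_sub]

theorem sub_tprod (A A' : Tensor a b c) (B : Tensor b d c) :
    (A - A') ∗ₜ B = A ∗ₜ B - A' ∗ₜ B :=
  hat_ext fun k => by simp only [hat_tprod, hat_sub, Matrix.sub_mul]

theorem inner_dct (A B : Tensor a b c) : ⟪dct A, dct B⟫_ℝ = ⟪A, B⟫_ℝ := by
  have tube (i j) :
      ∑ k, dct A (i, j, k) * dct B (i, j, k) = ∑ k, A (i, j, k) * B (i, j, k) := by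
    change (dctMatrix c *ᵥ fun l => A (i, j, l)) ⬝ᵥ (dctMatrix c *ᵥ fun l => B (i, j, l)) =
        (fun l => A (i, j, l)) ⬝ᵥ fun l => B (i, j, l)
    rw [dotProduct_mulVec, ← mulVec_transpose, mulVec_mulVec, transpose_mul_dctMatrix, one_mulVec]
  simp only [PiLp.inner_apply, Fintype.sum_prod_type, RCLike.inner_apply, conj_trivial]
  refine Finset.sum_congr rfl fun i _ => Finset.sum_congr rfl fun j _ => ?_
  simpa only [mul_comm] using tube i j

theorem inner_eq_sum_trace (A B : Tensor a b c) :
    ⟪A, B⟫_ℝ = ∑ k, ((hat A k)ᵀ * hat B k).trace := by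
  rw [← inner_dct]
  simp only [PiLp.inner_apply, Fintype.sum_prod_type, RCLike.inner_apply, conj_trivial,
    trace, diag_apply, mul_apply, transpose_apply]
  conv_rhs => rw [Finset.sum_comm]
  rw [Finset.sum_comm]
  refine Finset.sum_congr rfl fun j _ => ?_
  rw [Finset.sum_comm]
  exact Finset.sum_congr rfl fun k _ => Finset.sum_congr rfl fun i _ => mul_comm _ _

theorem norm_sq_eq_sum_frobSq (A : Tensor a b c) : ‖A‖ ^ 2 = ∑ k, frobSq (hat A k) := by
  rw [← real_inner_self_eq_norm_sq, inner_eq_sum_trace]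
  rfl

theorem norm_le_norm_of_hat {a' b' : ℕ} {A : Tensor a b c} {B : Tensor a' b' c}
    (h : ∀ k, frobSq (hat A k) ≤ frobSq (hat B k)) : ‖A‖ ≤ ‖B‖ := by
  refine le_of_sq_le_sq ?_ (norm_nonneg _)
  rw [norm_sq_eq_sum_frobSq, norm_sq_eq_sum_frobSq]
  exact Finset.sum_le_sum fun k _ => h k

theorem norm_tr (A : Tensor a b c) : ‖tr A‖ = ‖A‖ :=
  le_antisymm (norm_le_norm_of_hat fun k => by rw [hat_tr, frobSq_transpose])
    (norm_le_norm_of_hat fun k => by rw [hat_tr, frobSq_transpose])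

theorem norm_tprod_le (A : Tensor a b c) (B : Tensor b d c) : ‖A ∗ₜ B‖ ≤ ‖A‖ * ‖B‖ := by
  refine le_of_sq_le_sq ?_ (by positivity)
  rw [mul_pow, norm_sq_eq_sum_frobSq, norm_sq_eq_sum_frobSq A, norm_sq_eq_sum_frobSq B,
    Finset.sum_mul]
  refine Finset.sum_le_sum fun k _ => ?_
  calc frobSq (hat (A ∗ₜ B) k) ≤ frobSq (hat A k) * frobSq (hat B k) := by
        rw [hat_tprod]; exact frobSq_mul_le _ _
    _ ≤ frobSq (hat A k) * ∑ l, frobSq (hat B l) := by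
        gcongr
        · exact frobSq_nonneg _
        · exact Finset.single_le_sum (f := fun l => frobSq (hat B l))
            (fun _ _ => frobSq_nonneg _) (Finset.mem_univ k)

theorem inner_tprod_left (A : Tensor a b c) (B : Tensor b d c) (C : Tensor a d c) :
    ⟪A ∗ₜ B, C⟫_ℝ = ⟪B, tr A ∗ₜ C⟫_ℝ := by
  simp only [inner_eq_sum_trace, hat_tprod, hat_tr, transpose_mul, Matrix.mul_assoc]

theorem inner_tr (A B : Tensor a b c) : ⟪tr A, tr B⟫_ℝ = ⟪A, B⟫_ℝ := by
  simp only [inner_eq_sum_trace, hat_tr, transpose_transpose]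
  refine Finset.sum_congr rfl fun k _ => ?_
  rw [← trace_transpose, transpose_mul, transpose_transpose, trace_mul_comm]

theorem inner_tprod_right (A : Tensor a b c) (B : Tensor b d c) (C : Tensor a d c) :
    ⟪A ∗ₜ B, C⟫_ℝ = ⟪A, C ∗ₜ tr B⟫_ℝ := by
  rw [← inner_tr, tr_tprod, inner_tprod_left, ← inner_tr A, tr_tprod]

theorem eq_zero_of_tr_tprod_self {A : Tensor a b c} (h : tr A ∗ₜ A = 0) : A = 0 := by
  refine hat_ext fun k => ?_
  rw [hat_zero, ← conjTranspose_mul_self_eq_zero, conjTranspose_eq_transpose_of_trivial,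
    ← hat_tr, ← hat_tprod, h, hat_zero]

theorem exists_eq_tprod_of_multiRank_eq {A : Tensor a b c} {U : Tensor a d c} {T : Tensor d b c}
    (h : A = U ∗ₜ T) (hrank : multiRank A = multiRank U) : ∃ M : Tensor b d c, U = A ∗ₜ M := by
  have slicewise (k) : ∃ N : Matrix (Fin b) (Fin d) ℝ, hat U k = hat A k * N := by
    have range_eq : (hat A k).mulVecLin.range = (hat U k).mulVecLin.range := by
      refine Submodule.eq_of_le_of_finrank_eq ?_ (congrFun hrank k)
      rw [h, hat_tprod, mulVecLin_mul]
      exact LinearMap.range_comp_le_range _ _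
    have column (j) : ∃ v, hat A k *ᵥ v = (hat U k)ᵀ j := by
      have : (hat U k)ᵀ j ∈ (hat U k).mulVecLin.range :=
        ⟨Pi.single j 1, by rw [mulVecLin_apply, mulVec_single_one]; rfl⟩
      rwa [← range_eq] at this
    choose v hv using column
    exact ⟨(of v)ᵀ, by ext i j; exact (congrFun (hv j) i).symm⟩
  choose N hN using slicewise
  refine ⟨idct (mk fun i j k => N k i j), hat_ext fun k => ?_⟩
  rw [hat_tprod, hat_idct]
  exact hN k

end Slices

section Multiplication

variable {a b c d : ℕ}

/-- Multiplication by a fixed tensor on the left. -/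
def leftMul (A : Tensor a b c) : Tensor b d c →L[ℝ] Tensor a d c :=
  LinearMap.toContinuousLinearMap
    { toFun := fun Z => A ∗ₜ Z
      map_add' := tprod_add A
      map_smul' := fun t => tprod_smul t A }

/-- Multiplication by a fixed tensor on the right. -/
def rightMul (B : Tensor b d c) : Tensor a b c →L[ℝ] Tensor a d c :=
  LinearMap.toContinuousLinearMap
    { toFun := fun Z => Z ∗ₜ B
      map_add' := fun Z Z' => add_tprod Z Z' B
      map_smul' := fun t Z => smul_tprod t Z B }

@[simp] theorem leftMul_apply (A : Tensor a b c) (Z : Tensor b d c) : leftMul A Z = A ∗ₜ Z := rfl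

@[simp] theorem rightMul_apply (B : Tensor b d c) (Z : Tensor a b c) : rightMul B Z = Z ∗ₜ B := rfl

theorem adjoint_leftMul (A : Tensor a b c) :
    (leftMul A : Tensor b d c →L[ℝ] Tensor a d c).adjoint = leftMul (tr A) := by
  refine ((ContinuousLinearMap.eq_adjoint_iff _ _).2 fun C B => ?_).symm
  rw [leftMul_apply, leftMul_apply, inner_tprod_left, tr_tr]

theorem adjoint_rightMul (B : Tensor b d c) :
    (rightMul B : Tensor a b c →L[ℝ] Tensor a d c).adjoint = rightMul (tr B) := by
  refine ((ContinuousLinearMap.eq_adjoint_iff _ _).2 fun C A => ?_).symm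
  rw [rightMul_apply, rightMul_apply, inner_tprod_right, tr_tr]

theorem norm_leftMul_sub_le (A A' : Tensor a b c) :
    ‖(leftMul A - leftMul A' : Tensor b d c →L[ℝ] Tensor a d c)‖ ≤ ‖A - A'‖ := by
  refine ContinuousLinearMap.opNorm_le_bound _ (norm_nonneg _) fun Z => ?_
  rw [sub_apply, leftMul_apply, leftMul_apply, ← sub_tprod]
  exact norm_tprod_le _ _

theorem norm_rightMul_sub_le (B B' : Tensor b d c) :
    ‖(rightMul B - rightMul B' : Tensor a b c →L[ℝ] Tensor a d c)‖ ≤ ‖B - B'‖ := by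
  refine ContinuousLinearMap.opNorm_le_bound _ (norm_nonneg _) fun Z => ?_
  rw [sub_apply, rightMul_apply, rightMul_apply, ← tprod_sub, mul_comm]
  exact norm_tprod_le _ _

end Multiplication

section PartialIsometry

variable {E F : Type*} [NormedAddCommGroup E] [InnerProductSpace ℝ E] [FiniteDimensional ℝ E]
  [NormedAddCommGroup F] [InnerProductSpace ℝ F] [FiniteDimensional ℝ F]

theorem starProjection_range_of_comp_adjoint_comp {T : F →L[ℝ] E}
    (h : ∀ u, T (T.adjoint (T u)) = T u) : T.range.starProjection = T ∘L T.adjoint := by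
  ext v
  refine Submodule.eq_starProjection_of_mem_orthogonal ⟨T.adjoint v, rfl⟩ fun w hw => ?_
  obtain ⟨u, rfl⟩ := hw
  simp only [ContinuousLinearMap.coe_coe, ContinuousLinearMap.comp_apply]
  rw [inner_sub_right, ← T.adjoint_inner_left, T.adjoint_inner_right, h, sub_self]

end PartialIsometry

/-! ### Frames and tangent spaces -/

section Frame

open Matrix

variable {a b c : ℕ} {r : Fin c → ℕ}

/-- The orthonormality condition `Uᵀ ∗ₜ U = I_r` on the factors of a skinny `t_c`-SVD: in the
transform domain every slice is a partial isometry. -/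
def IsFrame (r : Fin c → ℕ) (U : Tensor a (maxRank r) c) : Prop := tr U ∗ₜ U = partialId r

theorem hat_partialId (r : Fin c → ℕ) (k : Fin c) :
    hat (partialId r) k = diagonal fun i => if i.val < r k then 1 else 0 := by
  rw [partialId, hat_idct]
  ext i j
  by_cases h : i = j <;> simp [slice, h]

theorem partialId_tprod_self (r : Fin c → ℕ) : partialId r ∗ₜ partialId r = partialId r :=
  hat_ext fun k => by simp [hat_tprod, hat_partialId, diagonal_mul_diagonal]

theorem IsFrame.tprod_partialId {U : Tensor a (maxRank r) c} (hU : IsFrame r U) :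
    U ∗ₜ partialId r = U := by
  have tr_partialId : tr (partialId r) = partialId r := by
    rw [← hU, tr_tprod, tr_tr]
  have gram (Z : Tensor _ (maxRank r) c) : tr U ∗ₜ (U ∗ₜ Z) = partialId r ∗ₜ Z := by
    rw [← hU, tprod_assoc]
  refine sub_eq_zero.1 (eq_zero_of_tr_tprod_self ?_)
  simp only [tr_sub, sub_tprod, tprod_sub, tr_tprod, tr_partialId, tprod_assoc, gram,
    partialId_tprod_self, show tr U ∗ₜ U = partialId r from hU, sub_self]

theorem IsFrame.tprod_tr_tprod {U : Tensor a (maxRank r) c} (hU : IsFrame r U) :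
    U ∗ₜ (tr U ∗ₜ U) = U :=
  hU.symm ▸ hU.tprod_partialId

theorem IsFrame.tr_tprod_tprod_tr {U : Tensor a (maxRank r) c} (hU : IsFrame r U) :
    tr U ∗ₜ U ∗ₜ tr U = tr U := by
  have := congrArg tr hU.tprod_tr_tprod
  rwa [tr_tprod, tr_tprod, tr_tr] at this

theorem IsFrame.starProjection_range_leftMul {U : Tensor a (maxRank r) c} (hU : IsFrame r U) :
    (leftMul U : Tensor _ b c →L[ℝ] _).range.starProjection = leftMul (U ∗ₜ tr U) := by
  rw [starProjection_range_of_comp_adjoint_comp, adjoint_leftMul]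
  · ext1 Z
    simp only [ContinuousLinearMap.comp_apply, leftMul_apply, tprod_assoc]
  · intro Z
    simp only [adjoint_leftMul, leftMul_apply, ← tprod_assoc]
    rw [tprod_assoc U, hU.tprod_tr_tprod]

theorem IsFrame.starProjection_range_rightMul {V : Tensor b (maxRank r) c} (hV : IsFrame r V) :
    (rightMul (tr V) : Tensor a _ c →L[ℝ] _).range.starProjection = rightMul (V ∗ₜ tr V) := by
  rw [starProjection_range_of_comp_adjoint_comp, adjoint_rightMul, tr_tr]
  · ext1 Z
    simp only [ContinuousLinearMap.comp_apply, rightMul_apply, tprod_assoc]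
  · intro Z
    simp only [adjoint_rightMul, rightMul_apply, tr_tr, tprod_assoc]
    rw [← tprod_assoc (tr V), hV.tr_tprod_tprod_tr]

theorem IsFrame.finrank_range_leftMul {U : Tensor a (maxRank r) c} (hU : IsFrame r U) :
    Module.finrank ℝ (leftMul U : Tensor _ b c →L[ℝ] _).range =
      Module.finrank ℝ (leftMul (partialId r) : Tensor _ b c →L[ℝ] _).range := by
  set T : Tensor _ b c →L[ℝ] Tensor a b c := leftMul U
  have gram : T.adjoint ∘L T = leftMul (partialId r) := by
    ext1 Z
    rw [adjoint_leftMul, ← hU, ContinuousLinearMap.comp_apply, leftMul_apply, leftMul_apply,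
      leftMul_apply, tprod_assoc]
  rw [← gram, ← LinearMap.finrank_range_adjoint, ← LinearMap.range_adjoint_comp_self]
  rfl

theorem IsFrame.finrank_range_rightMul {V : Tensor b (maxRank r) c} (hV : IsFrame r V) :
    Module.finrank ℝ (rightMul (tr V) : Tensor a _ c →L[ℝ] _).range =
      Module.finrank ℝ (rightMul (partialId r) : Tensor a _ c →L[ℝ] _).range := by
  set T : Tensor a _ c →L[ℝ] Tensor a b c := rightMul (tr V)
  have gram : T.adjoint ∘L T = rightMul (partialId r) := by
    ext1 Z
    rw [adjoint_rightMul, ← hV, ContinuousLinearMap.comp_apply, rightMul_apply, rightMul_apply,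
      rightMul_apply, tr_tr, tprod_assoc]
  rw [← gram, ← LinearMap.finrank_range_adjoint, ← LinearMap.range_adjoint_comp_self]
  rfl

/-- The tangent space `{U ∗ₜ Z₁ + Z₂ ∗ₜ Vᵀ}` of the fixed multi-rank manifold at a point with
factors `U` and `V`. -/
def tangentSpace (U : Tensor a (maxRank r) c) (V : Tensor b (maxRank r) c) :
    Submodule ℝ (Tensor a b c) :=
  (leftMul U).range ⊔ (rightMul (tr V)).range

variable {U : Tensor a (maxRank r) c} {V : Tensor b (maxRank r) c}

theorem IsFrame.commute_starProjection (hU : IsFrame r U) (hV : IsFrame r V) :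
    Commute (leftMul U : Tensor _ b c →L[ℝ] _).range.starProjection
      (rightMul (tr V) : Tensor a _ c →L[ℝ] _).range.starProjection := by
  rw [hU.starProjection_range_leftMul, hV.starProjection_range_rightMul]
  ext1 Z
  exact (tprod_assoc (U ∗ₜ tr U) Z (V ∗ₜ tr V)).symm

theorem starProjection_tangentSpace (hU : IsFrame r U) (hV : IsFrame r V) :
    (tangentSpace U V).starProjection = tangentProj U V := by
  rw [tangentSpace, starProjection_sup (hU.commute_starProjection hV),
    hU.starProjection_range_leftMul, hV.starProjection_range_rightMul]
  ext1 Z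
  change U ∗ₜ tr U ∗ₜ Z + Z ∗ₜ (V ∗ₜ tr V) - U ∗ₜ tr U ∗ₜ (Z ∗ₜ (V ∗ₜ tr V)) =
    U ∗ₜ tr U ∗ₜ Z + Z ∗ₜ V ∗ₜ tr V - U ∗ₜ tr U ∗ₜ Z ∗ₜ V ∗ₜ tr V
  simp only [tprod_assoc]

end Frame

section SigmaMin

open Matrix

variable {a b c d : ℕ}

/-- The `j`-th lateral slice in the transform domain, as a vector on which `bdiag` acts. -/
def lateralSlice (Z : Tensor b d c) (j : Fin d) : EuclideanSpace ℝ (Fin b × Fin c) :=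
  WithLp.toLp 2 fun x => dct Z (x.1, j, x.2)

theorem norm_sq_eq_sum_lateralSlice (Z : Tensor b d c) : ‖Z‖ ^ 2 = ∑ j, ‖lateralSlice Z j‖ ^ 2 := by
  rw [← real_inner_self_eq_norm_sq, ← inner_dct, real_inner_self_eq_norm_sq]
  simp only [EuclideanSpace.norm_sq_eq, Fintype.sum_prod_type]
  rw [Finset.sum_comm]
  rfl

theorem lateralSlice_tprod (A : Tensor a b c) (Z : Tensor b d c) (j : Fin d) :
    lateralSlice (A ∗ₜ Z) j = toEuclideanLin (bdiag A) (lateralSlice Z j) := by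
  ext ⟨i, k⟩
  change hat (A ∗ₜ Z) k i j = ∑ x, blockDiagonal (hat A) (i, k) x * hat Z x.2 x.1 j
  simp [hat_tprod, mul_apply, blockDiagonal_apply, Fintype.sum_prod_type]

theorem bdiag_tr (A : Tensor a b c) : bdiag (tr A) = (bdiag A)ᵀ := by
  rw [bdiag, bdiag, blockDiagonal_transpose]
  exact congrArg blockDiagonal (funext (hat_tr A))

theorem lateralSlice_tr_tprod (A : Tensor a b c) (Z : Tensor a d c) (j : Fin d) :
    lateralSlice (tr A ∗ₜ Z) j = (toEuclideanLin (bdiag A)).adjoint (lateralSlice Z j) := by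
  rw [lateralSlice_tprod, bdiag_tr, ← conjTranspose_eq_transpose_of_trivial,
    toEuclideanLin_conjTranspose_eq_adjoint]

theorem mul_norm_le_norm_of_lateralSlice {b' : ℕ} {σ : ℝ} (hσ : 0 ≤ σ) {Z : Tensor b d c}
    {Z' : Tensor b' d c} (h : ∀ j, σ * ‖lateralSlice Z j‖ ≤ ‖lateralSlice Z' j‖) :
    σ * ‖Z‖ ≤ ‖Z'‖ := by
  refine le_of_sq_le_sq ?_ (norm_nonneg _)
  rw [mul_pow, norm_sq_eq_sum_lateralSlice, norm_sq_eq_sum_lateralSlice, Finset.mul_sum]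
  refine Finset.sum_le_sum fun j _ => ?_
  rw [← mul_pow]
  gcongr
  exact h j

theorem sigmaMin_nonneg (A : Tensor a b c) : 0 ≤ sigmaMin A :=
  minSingularValue_nonneg _

theorem sigmaMin_mul_norm_tprod_le (A : Tensor a b c) (Z : Tensor b d c) :
    sigmaMin A * ‖A ∗ₜ Z‖ ≤ ‖tr A ∗ₜ (A ∗ₜ Z)‖ := by
  refine mul_norm_le_norm_of_lateralSlice (sigmaMin_nonneg A) fun j => ?_
  rw [lateralSlice_tr_tprod, lateralSlice_tprod]
  exact minSingularValue_mul_norm_apply_le _ _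

theorem sigmaMin_mul_norm_tr_tprod_le (A : Tensor a b c) (Z : Tensor a d c) :
    sigmaMin A * ‖tr A ∗ₜ Z‖ ≤ ‖A ∗ₜ (tr A ∗ₜ Z)‖ := by
  refine mul_norm_le_norm_of_lateralSlice (sigmaMin_nonneg A) fun j => ?_
  rw [lateralSlice_tprod A, lateralSlice_tr_tprod]
  exact minSingularValue_mul_norm_adjoint_le _ _

theorem sigmaMin_mul_norm_tprod_right_le (A : Tensor a b c) (Z : Tensor d a c) :
    sigmaMin A * ‖Z ∗ₜ A‖ ≤ ‖Z ∗ₜ A ∗ₜ tr A‖ := by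
  have := sigmaMin_mul_norm_tr_tprod_le A (tr Z)
  rw [← tr_tprod, norm_tr] at this
  rwa [← norm_tr (Z ∗ₜ A ∗ₜ tr A), tr_tprod, tr_tr]

theorem sigmaMin_pos {A : Tensor a b c} (hA : A ≠ 0) : 0 < sigmaMin A := by
  refine minSingularValue_pos fun h => hA (hat_ext fun k => ?_)
  have bdiag_eq_zero : blockDiagonal (hat A) = 0 := toEuclideanLin.map_eq_zero_iff.1 h
  rw [hat_zero, ← blockDiag_blockDiagonal (hat A), bdiag_eq_zero]
  rfl

end SigmaMin

section Tangent

variable {a b c : ℕ} {r : Fin c → ℕ} {X Y : Tensor a b c} {U U' : Tensor a (maxRank r) c}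
  {S S' : Tensor (maxRank r) (maxRank r) c} {V V' : Tensor b (maxRank r) c}

theorem range_leftMul_le_of_eq_tprod {A : Tensor a b c} {d e : ℕ} {B : Tensor a d c}
    {T : Tensor d b c} (h : A = B ∗ₜ T) :
    (leftMul A : Tensor b e c →L[ℝ] _).range ≤ (leftMul B : Tensor d e c →L[ℝ] _).range := by
  rintro _ ⟨Z, rfl⟩
  exact ⟨T ∗ₜ Z, by simp [h, tprod_assoc]⟩

theorem range_rightMul_le_of_eq_tprod {A : Tensor a b c} {d e : ℕ} {B : Tensor d b c}
    {T : Tensor a d c} (h : A = T ∗ₜ B) :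
    (rightMul A : Tensor e a c →L[ℝ] _).range ≤ (rightMul B : Tensor e d c →L[ℝ] _).range := by
  rintro _ ⟨Z, rfl⟩
  exact ⟨Z ∗ₜ T, by simp [h, tprod_assoc]⟩

theorem multiRank_tr (A : Tensor a b c) : multiRank (tr A) = multiRank A :=
  funext fun k => (congrArg Matrix.rank (hat_tr A k)).trans (Matrix.rank_transpose _)

theorem IsSkinnySVD.range_leftMul (h : IsSkinnySVD r X U S V) :
    (leftMul X : Tensor b b c →L[ℝ] _).range = (leftMul U).range := by
  have factored : X = U ∗ₜ (S ∗ₜ tr V) := by rw [h.eq, tprod_assoc]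
  obtain ⟨M, hM⟩ := exists_eq_tprod_of_multiRank_eq factored
    (h.multiRank_eq.trans h.multiRank_left.symm)
  exact le_antisymm (range_leftMul_le_of_eq_tprod factored) (range_leftMul_le_of_eq_tprod hM)

theorem IsSkinnySVD.range_rightMul (h : IsSkinnySVD r X U S V) :
    (rightMul X : Tensor a a c →L[ℝ] _).range = (rightMul (tr V)).range := by
  have factored : tr X = V ∗ₜ (tr S ∗ₜ tr U) := by
    rw [h.eq, tr_tprod, tr_tprod, tr_tr]
  obtain ⟨M, hM⟩ := exists_eq_tprod_of_multiRank_eq factored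
    ((multiRank_tr X).trans (h.multiRank_eq.trans h.multiRank_right.symm))
  exact le_antisymm (range_rightMul_le_of_eq_tprod h.eq)
    (range_rightMul_le_of_eq_tprod (T := tr M) (by rw [hM, tr_tprod, tr_tr]))

theorem IsSkinnySVD.norm_starProjection_left_sub_le (hX : IsSkinnySVD r X U S V) (hX₀ : X ≠ 0)
    (hU' : IsFrame r U') (hY : Y = U' ∗ₜ S' ∗ₜ tr V') :
    ‖(leftMul U : Tensor _ b c →L[ℝ] _).range.starProjection -
        (leftMul U' : Tensor _ b c →L[ℝ] _).range.starProjection‖ ≤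
      ‖X - Y‖ / sigmaMin X := by
  simp only [← hX.range_leftMul]
  refine (norm_starProjection_range_sub_le (T' := leftMul Y) ?_
    (range_leftMul_le_of_eq_tprod (by rw [hY, tprod_assoc])) (sigmaMin_pos hX₀)
    fun Z => ?_).trans ?_
  · rw [hX.range_leftMul, IsFrame.finrank_range_leftMul hX.left, hU'.finrank_range_leftMul]
  · rw [adjoint_leftMul]
    exact sigmaMin_mul_norm_tprod_le X Z
  · gcongr
    · exact sigmaMin_nonneg X
    · exact norm_leftMul_sub_le X Y

theorem IsSkinnySVD.norm_starProjection_right_sub_le (hX : IsSkinnySVD r X U S V) (hX₀ : X ≠ 0)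
    (hV' : IsFrame r V') (hY : Y = U' ∗ₜ S' ∗ₜ tr V') :
    ‖(rightMul (tr V) : Tensor a _ c →L[ℝ] _).range.starProjection -
        (rightMul (tr V') : Tensor a _ c →L[ℝ] _).range.starProjection‖ ≤
      ‖X - Y‖ / sigmaMin X := by
  simp only [← hX.range_rightMul]
  refine (norm_starProjection_range_sub_le (T' := rightMul Y) ?_
    (range_rightMul_le_of_eq_tprod hY) (sigmaMin_pos hX₀) fun Z => ?_).trans ?_
  · rw [hX.range_rightMul, IsFrame.finrank_range_rightMul hX.right, hV'.finrank_range_rightMul]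
  · rw [adjoint_rightMul]
    exact sigmaMin_mul_norm_tprod_right_le X Z
  · gcongr
    · exact sigmaMin_nonneg X
    · exact norm_rightMul_sub_le X Y

theorem IsSkinnySVD.norm_starProjection_tangentSpace_sub_le (hX : IsSkinnySVD r X U S V)
    (hX₀ : X ≠ 0) (hU' : IsFrame r U') (hV' : IsFrame r V') (hY : Y = U' ∗ₜ S' ∗ₜ tr V') :
    ‖(tangentSpace U' V').starProjection - (tangentSpace U V).starProjection‖ ≤
      2 * (‖Y - X‖ / sigmaMin X) := by
  rw [norm_sub_rev, norm_sub_rev Y, two_mul]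
  exact (norm_starProjection_sup_sub_le (IsFrame.commute_starProjection hX.left hX.right)
    (hU'.commute_starProjection hV')).trans (add_le_add
      (hX.norm_starProjection_left_sub_le hX₀ hU' hY)
      (hX.norm_starProjection_right_sub_le hX₀ hV' hY))

-- The normal component of the error is quadratic in the error: `X` lies in the left summand of the
-- tangent space at `X` and `Y` in the right summand of the one at `Y`.
theorem IsSkinnySVD.norm_sub_starProjection_tangentSpace_le (hX : IsSkinnySVD r X U S V)
    (hX₀ : X ≠ 0) (hU' : IsFrame r U') (hV' : IsFrame r V') (hY : Y = U' ∗ₜ S' ∗ₜ tr V') :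
    ‖(Y - X) - (tangentSpace U' V').starProjection (Y - X)‖ ≤
      ‖Y - X‖ / sigmaMin X * ‖Y - X‖ := by
  have X_mem : X ∈ (leftMul U : Tensor _ b c →L[ℝ] _).range :=
    ⟨S ∗ₜ tr V, by simp [hX.eq, tprod_assoc]⟩
  have Y_mem : Y ∈ (rightMul (tr V') : Tensor a _ c →L[ℝ] _).range := ⟨U' ∗ₜ S', hY.symm⟩
  rw [← norm_neg, neg_sub', ← map_neg, neg_sub, norm_sub_rev Y]
  refine (norm_sub_starProjection_sup_le (hU'.commute_starProjection hV')
    (IsFrame.commute_starProjection hX.left hV') X_mem Y_mem).trans ?_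
  gcongr
  exact hX.norm_starProjection_left_sub_le hX₀ hU' hY

end Tangent

/-! ### Best approximation by truncation -/

section IsometricFactors

open Matrix

variable {l m n : Type*} [Fintype l] [Fintype m] [Fintype n]

theorem transpose_mul_self_of_isStarProjection {Q : Matrix n n ℝ} (hQ : IsStarProjection Q) :
    Qᵀ * Q = Q := by
  rw [← conjTranspose_eq_transpose_of_trivial, ← star_eq_conjTranspose, hQ.isSelfAdjoint.star_eq,
    hQ.isIdempotentElem.eq]

theorem frobSq_mul_of_isStarProjection {Q : Matrix n n ℝ} (hQ : IsStarProjection Q)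
    (M : Matrix n l ℝ) : frobSq (Q * M) = (Mᵀ * (Q * M)).trace := by
  rw [frobSq, transpose_mul, Matrix.mul_assoc, ← Matrix.mul_assoc Qᵀ,
    transpose_mul_self_of_isStarProjection hQ]

theorem diag_mem_Icc_of_isStarProjection {Q : Matrix n n ℝ} (hQ : IsStarProjection Q) (i : n) :
    Q i i ∈ Set.Icc 0 1 := by
  have sum_sq : Q i i = ∑ j, Q j i ^ 2 := by
    conv_lhs => rw [← transpose_mul_self_of_isStarProjection hQ, Matrix.mul_apply]
    simp only [transpose_apply, sq]
  have sq_le : Q i i ^ 2 ≤ Q i i :=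
    (Finset.single_le_sum (f := fun j => Q j i ^ 2) (fun _ _ => sq_nonneg _)
      (Finset.mem_univ i)).trans_eq sum_sq.symm
  exact ⟨(sq_nonneg _).trans sq_le, by nlinarith⟩

theorem frobSq_mul_le_of_isStarProjection {Q : Matrix n n ℝ} (hQ : IsStarProjection Q)
    (M : Matrix n l ℝ) : frobSq (Q * M) ≤ frobSq M := by
  classical
  have pythagoras : frobSq M = frobSq (Q * M) + frobSq ((1 - Q) * M) := by
    rw [frobSq_mul_of_isStarProjection hQ, frobSq_mul_of_isStarProjection hQ.one_sub,
      ← trace_add, ← Matrix.mul_add, ← Matrix.add_mul, add_sub_cancel, Matrix.one_mul, frobSq]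
  linarith [frobSq_nonneg ((1 - Q) * M)]

variable [DecidableEq n]

theorem frobSq_mul_of_left {U : Matrix m n ℝ} (hU : Uᵀ * U = 1) (M : Matrix n l ℝ) :
    frobSq (U * M) = frobSq M := by
  rw [frobSq, frobSq, transpose_mul, Matrix.mul_assoc, ← Matrix.mul_assoc Uᵀ, hU, Matrix.one_mul]

theorem frobSq_mul_of_right {V : Matrix m n ℝ} (hV : Vᵀ * V = 1) (M : Matrix l n ℝ) :
    frobSq (M * Vᵀ) = frobSq M := by
  rw [← frobSq_transpose, transpose_mul, transpose_transpose, frobSq_mul_of_left hV,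
    frobSq_transpose]

theorem isStarProjection_transpose_mul_mul {Q U : Matrix n n ℝ} (hU : Uᵀ * U = 1)
    (hQ : IsStarProjection Q) : IsStarProjection (Uᵀ * Q * U) where
  isIdempotentElem := by
    calc Uᵀ * Q * U * (Uᵀ * Q * U) = Uᵀ * Q * (U * Uᵀ) * Q * U := by
          simp only [Matrix.mul_assoc]
      _ = Uᵀ * (Q * Q) * U := by
          rw [mul_eq_one_comm.1 hU, Matrix.mul_one, Matrix.mul_assoc Uᵀ]
      _ = Uᵀ * Q * U := by rw [hQ.isIdempotentElem.eq]
  isSelfAdjoint := by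
    simpa only [star_eq_conjTranspose, conjTranspose_eq_transpose_of_trivial] using
      hQ.isSelfAdjoint.conjugate' U

end IsometricFactors

section Selection

open Matrix

/-- The rectangular matrix `diag (I_s, 0)`. -/
def selection (a b s : ℕ) : Matrix (Fin a) (Fin b) ℝ :=
  Matrix.of fun i j => if i.val = j.val ∧ i.val < s then 1 else 0

variable {a b d s : ℕ}

theorem selection_transpose : (selection a b s)ᵀ = selection b a s := by
  ext j i
  exact if_congr (by omega) rfl rfl

theorem selection_self : selection a a s = diagonal fun i => if i.val < s then 1 else 0 := by
  ext i j
  simp [selection, diagonal_apply, Fin.ext_iff, ite_and]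

theorem selection_mul_apply {n : Type*} (M : Matrix (Fin b) n ℝ) (i : Fin a) (j : n) :
    (selection a b s * M) i j =
      if h : i.val < s ∧ i.val < b then M ⟨i.val, h.2⟩ j else 0 := by
  rw [Matrix.mul_apply]
  split_ifs with h
  · rw [Finset.sum_eq_single ⟨i.val, h.2⟩ (fun l _ hl => ?_) (by simp)]
    · simp [selection, h.1]
    · have : i.val ≠ l.val := fun h' => hl (Fin.ext h'.symm)
      simp [selection, this]
  · refine Finset.sum_eq_zero fun l _ => ?_
    have : ¬ (i.val = l.val ∧ i.val < s) := fun h' => h ⟨h'.2, h'.1 ▸ l.isLt⟩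
    simp [selection, this]

theorem mul_selection_apply {m : Type*} (M : Matrix m (Fin a) ℝ) (i : m) (j : Fin b) :
    (M * selection a b s) i j =
      if h : j.val < s ∧ j.val < a then M i ⟨j.val, h.2⟩ else 0 := by
  rw [← transpose_apply (M * _), transpose_mul, selection_transpose, selection_mul_apply]
  rfl

theorem selection_mul_selection (h : s ≤ b) :
    selection a b s * selection b d s = selection a d s := by
  ext i j
  rw [selection_mul_apply]
  split_ifs with hi
  · rfl
  · exact (if_neg (by omega)).symm

theorem trace_selection (h : s ≤ a) : (selection a a s).trace = s := by
  rw [selection_self, trace_diagonal, Finset.sum_boole, Fin.card_filter_val_lt, min_eq_right h]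

end Selection

section EckartYoung

open Matrix

/-- The middle factor of a singular value decomposition: a rectangular diagonal matrix with
nonnegative nonincreasing diagonal. -/
structure IsSingularValueMatrix {a b : ℕ} (S : Matrix (Fin a) (Fin b) ℝ) : Prop where
  diagonal : ∀ i j, i.val ≠ j.val → S i j = 0
  nonneg : ∀ i j, i.val = j.val → 0 ≤ S i j
  antitone : ∀ i i' j j', i.val = j.val → i'.val = j'.val → i.val ≤ i'.val → S i' j' ≤ S i j

variable {a b s : ℕ} {U : Matrix (Fin a) (Fin a) ℝ} {S : Matrix (Fin a) (Fin b) ℝ}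
  {V : Matrix (Fin b) (Fin b) ℝ}

theorem selection_mul_mul_selection (hS : ∀ i j, i.val ≠ j.val → S i j = 0) :
    selection a a s * S * selection b b s = selection a a s * S := by
  ext i j
  rw [selection_self, selection_self, mul_diagonal, diagonal_mul]
  by_cases h : i.val = j.val
  · rw [← h]
    split_ifs <;> simp
  · simp [hS i j h]

theorem mul_transpose_eq_diagonal (hS : ∀ i j, i.val ≠ j.val → S i j = 0) :
    S * Sᵀ = diagonal fun i => ∑ j, S i j ^ 2 := by
  ext i i'
  rw [Matrix.mul_apply, diagonal_apply]
  split_ifs with h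
  · simp only [transpose_apply, h, sq]
  · refine Finset.sum_eq_zero fun j _ => mul_eq_zero.2 ?_
    by_cases hij : i.val = j.val
    · exact .inr (hS i' j fun h' => h (Fin.ext (hij.trans h'.symm)))
    · exact .inl (hS i j hij)

theorem IsSingularValueMatrix.antitone_sum_sq (hS : IsSingularValueMatrix S) :
    Antitone fun i => ∑ j, S i j ^ 2 := by
  intro i i' hii
  change ∑ j, S i' j ^ 2 ≤ ∑ j, S i j ^ 2
  by_cases h' : i'.val < b
  · have h : i.val < b := lt_of_le_of_lt hii h'
    calc ∑ j, S i' j ^ 2 = S i' ⟨i'.val, h'⟩ ^ 2 := by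
          refine Finset.sum_eq_single _ (fun j _ hj => ?_) (by simp)
          rw [hS.diagonal i' j fun h => hj (Fin.ext h.symm), zero_pow two_ne_zero]
      _ ≤ S i ⟨i.val, h⟩ ^ 2 :=
          pow_le_pow_left₀ (hS.nonneg _ _ rfl) (hS.antitone _ _ _ _ rfl rfl hii) 2
      _ ≤ ∑ j, S i j ^ 2 :=
          Finset.single_le_sum (f := fun j => S i j ^ 2) (fun _ _ => sq_nonneg _)
            (Finset.mem_univ _)
  · refine (Finset.sum_eq_zero fun j _ => ?_).trans_le (by positivity)
    rw [hS.diagonal i' j (by omega), zero_pow two_ne_zero]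

theorem sum_tail_le_sum_mul {t w : Fin a → ℝ} (ht : Antitone t) (hw₀ : ∀ i, 0 ≤ w i)
    (hw₁ : ∀ i, w i ≤ 1) (hw : ∑ i, w i = a - s) :
    ∑ i, (if i.val < s then 0 else t i) ≤ ∑ i, w i * t i := by
  have hsa : s ≤ a := by
    have : (0 : ℝ) ≤ a - s := hw ▸ Finset.sum_nonneg fun i _ => hw₀ i
    exact_mod_cast sub_nonneg.1 this
  rcases hsa.lt_or_eq with h | rfl
  · set θ := t ⟨s, h⟩
    have termwise (i : Fin a) : (if i.val < s then 0 else t i) ≤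
        w i * t i + (1 - (if i.val < s then 1 else 0) - w i) * θ := by
      split_ifs with hi
      · have : θ ≤ t i := ht (Fin.le_def.2 hi.le)
        nlinarith [hw₀ i]
      · have : t i ≤ θ := ht (Fin.le_def.2 (not_lt.1 hi))
        nlinarith [hw₁ i]
    have balance : ∑ i : Fin a, (1 - (if i.val < s then 1 else 0) - w i) = 0 := by
      rw [Finset.sum_sub_distrib, Finset.sum_sub_distrib, hw, Finset.sum_boole,
        Fin.card_filter_val_lt, min_eq_right hsa]
      simp
    calc _ ≤ ∑ i, (w i * t i + (1 - (if i.val < s then 1 else 0) - w i) * θ) :=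
          Finset.sum_le_sum fun i _ => termwise i
      _ = ∑ i, w i * t i := by
          rw [Finset.sum_add_distrib, ← Finset.sum_mul, balance, zero_mul, add_zero]
  · have w_eq_zero (i : Fin s) : w i = 0 :=
      (Finset.sum_eq_zero_iff_of_nonneg fun i _ => hw₀ i).1 (hw.trans (sub_self _)) i
        (Finset.mem_univ i)
    simp [w_eq_zero]

theorem frobSq_sub_truncation (hU : Uᵀ * U = 1) (hV : Vᵀ * V = 1) :
    frobSq (U * S * Vᵀ - U * (selection a a s * S) * Vᵀ) =
      ∑ i : Fin a, (if i.val < s then 0 else ∑ j, S i j ^ 2) := by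
  rw [← Matrix.sub_mul, ← Matrix.mul_sub, frobSq_mul_of_right hV, frobSq_mul_of_left hU,
    frobSq_eq_sum]
  refine Finset.sum_congr rfl fun i _ => ?_
  split_ifs with h <;> simp [selection_self, h]

/-- Only the part of the error orthogonal to the range of `P ⊇ range X` is kept. -/
theorem sum_mul_sum_sq_le_frobSq_sub (hV : Vᵀ * V = 1) (hS : ∀ i j, i.val ≠ j.val → S i j = 0)
    {P : Matrix (Fin a) (Fin a) ℝ} (hP : IsStarProjection P) {X : Matrix (Fin a) (Fin b) ℝ}
    (hPX : P * X = X) :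
    ∑ i, (Uᵀ * (1 - P) * U) i i * ∑ j, S i j ^ 2 ≤ frobSq (U * S * Vᵀ - X) := by
  calc ∑ i, (Uᵀ * (1 - P) * U) i i * ∑ j, S i j ^ 2
      = (Uᵀ * (1 - P) * U * (S * Sᵀ)).trace := by
        rw [mul_transpose_eq_diagonal hS]
        simp only [trace, diag_apply, mul_diagonal]
    _ = frobSq ((1 - P) * (U * S)) := by
        rw [frobSq_mul_of_isStarProjection hP.one_sub, transpose_mul, ← Matrix.mul_assoc,
          trace_mul_comm]
        simp only [Matrix.mul_assoc]
    _ = frobSq ((1 - P) * (U * S * Vᵀ - X)) := by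
        have annihilates : (1 - P) * X = 0 := by
          rw [Matrix.sub_mul, Matrix.one_mul, hPX, sub_self]
        rw [Matrix.mul_sub, annihilates, sub_zero, ← Matrix.mul_assoc _ (U * S),
          frobSq_mul_of_right hV]
    _ ≤ frobSq (U * S * Vᵀ - X) := frobSq_mul_le_of_isStarProjection hP.one_sub _

/-- The Eckart–Young theorem. The competitors of rank at most `s` are the matrices fixed by some
orthogonal projection `P` of rank `s`. -/
theorem eckart_young (hU : Uᵀ * U = 1) (hV : Vᵀ * V = 1) (hS : IsSingularValueMatrix S)
    {P : Matrix (Fin a) (Fin a) ℝ} (hP : IsStarProjection P) (hPs : P.trace = s)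
    {X : Matrix (Fin a) (Fin b) ℝ} (hPX : P * X = X) :
    frobSq (U * S * Vᵀ - U * (selection a a s * S) * Vᵀ) ≤ frobSq (U * S * Vᵀ - X) := by
  set K := Uᵀ * (1 - P) * U with hK
  have K_mem (i) : K i i ∈ Set.Icc 0 1 :=
    diag_mem_Icc_of_isStarProjection (isStarProjection_transpose_mul_mul hU hP.one_sub) i
  have trace_K : ∑ i, K i i = a - s := by
    change K.trace = _
    rw [hK, Matrix.mul_assoc, trace_mul_comm, Matrix.mul_assoc, mul_eq_one_comm.1 hU,
      Matrix.mul_one, trace_sub, trace_one, hPs, Fintype.card_fin]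
  calc _ = ∑ i : Fin a, (if i.val < s then 0 else ∑ j, S i j ^ 2) := frobSq_sub_truncation hU hV
    _ ≤ ∑ i, K i i * ∑ j, S i j ^ 2 :=
        sum_tail_le_sum_mul hS.antitone_sum_sq (fun i => (K_mem i).1) (fun i => (K_mem i).2)
          trace_K
    _ ≤ frobSq (U * S * Vᵀ - X) := sum_mul_sum_sq_le_frobSq_sub hV hS.diagonal hP hPX

end EckartYoung

section Truncation

open Matrix

variable {a b c : ℕ} {r : Fin c → ℕ}

theorem le_maxRank (r : Fin c → ℕ) (k : Fin c) : r k ≤ maxRank r :=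
  Finset.le_sup (Finset.mem_univ k)

theorem IsFrame.hat_transpose_mul_hat {U : Tensor a (maxRank r) c} (hU : IsFrame r U) (k : Fin c) :
    (hat U k)ᵀ * hat U k = selection (maxRank r) (maxRank r) (r k) := by
  rw [selection_self, ← hat_partialId, ← hU, hat_tprod, hat_tr]

theorem IsFrame.isStarProjection_hat {U : Tensor a (maxRank r) c} (hU : IsFrame r U) (k : Fin c) :
    IsStarProjection (hat U k * (hat U k)ᵀ) where
  isIdempotentElem := by
    rw [IsIdempotentElem, ← hat_tr, ← hat_tprod, ← hat_tprod, tprod_assoc U,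
      ← tprod_assoc (tr U), hU.tr_tprod_tprod_tr]
  isSelfAdjoint := by
    rw [← conjTranspose_eq_transpose_of_trivial]
    exact isHermitian_mul_conjTranspose_self (hat U k)

theorem IsFrame.trace_hat_mul_transpose {U : Tensor a (maxRank r) c} (hU : IsFrame r U)
    (k : Fin c) : (hat U k * (hat U k)ᵀ).trace = r k := by
  rw [trace_mul_comm, hU.hat_transpose_mul_hat, trace_selection (le_maxRank r k)]

theorem IsOrthogonal.hat_transpose_mul_hat {U : Tensor a a c} (hU : IsOrthogonal U) (k : Fin c) :
    (hat U k)ᵀ * hat U k = 1 := by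
  rw [← hat_tr, ← hat_tprod, hU.1, idTensor, hat_idct]
  rfl

theorem hat_apply_eq_zero_of_isDiagonal {S : Tensor a b c} (hS : IsDiagonal S) (k : Fin c)
    (i : Fin a) (j : Fin b) (h : i.val ≠ j.val) : hat S k i j = 0 := by
  change ∑ l, dctMatrix c k l * S (i, j, l) = 0
  simp [hS i j _ h]

theorem IsFullSVD.isSingularValueMatrix {W : Tensor a b c} {U : Tensor a a c} {S : Tensor a b c}
    {V : Tensor b b c} (h : IsFullSVD W U S V) (k : Fin c) : IsSingularValueMatrix (hat S k) where
  diagonal := hat_apply_eq_zero_of_isDiagonal h.diagonal k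
  nonneg i j := h.nonneg i j k
  antitone i i' j j' := h.antitone i i' j j' k

theorem hat_truncCols (U : Tensor a a c) (k : Fin c) :
    hat (truncCols r U) k = hat U k * selection a (maxRank r) (r k) := by
  ext i p
  rw [mul_selection_apply, truncCols, hat_idct]
  rfl

theorem hat_truncDiag {S : Tensor a b c} (hS : IsDiagonal S) (k : Fin c) :
    hat (truncDiag r S) k =
      selection (maxRank r) a (r k) * hat S k * selection b (maxRank r) (r k) := by
  ext p q
  rw [mul_selection_apply, truncDiag, hat_idct]
  simp only [slice, of_apply, mk_apply, selection_mul_apply]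
  split_ifs
  all_goals first | rfl | grind [hat_apply_eq_zero_of_isDiagonal]

theorem IsOrthogonal.isFrame_truncCols {U : Tensor a a c} (hU : IsOrthogonal U)
    (hr : ∀ k, r k ≤ a) : IsFrame r (truncCols r U) := by
  refine hat_ext fun k => ?_
  rw [hat_tprod, hat_tr, hat_truncCols, transpose_mul, Matrix.mul_assoc,
    ← Matrix.mul_assoc (hat U k)ᵀ, hU.hat_transpose_mul_hat, Matrix.one_mul, selection_transpose,
    selection_mul_selection (hr k), hat_partialId, selection_self]

variable {W : Tensor a b c} {U : Tensor a (maxRank r) c} {S : Tensor (maxRank r) (maxRank r) c}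
  {V : Tensor b (maxRank r) c}

theorem IsTruncatedSVD.isFrame_left (h : IsTruncatedSVD r W U S V) (hr : ∀ k, r k ≤ a) :
    IsFrame r U := by
  obtain ⟨U', S', V', hW, rfl, -, -⟩ := h
  exact hW.left.isFrame_truncCols hr

theorem IsTruncatedSVD.isFrame_right (h : IsTruncatedSVD r W U S V) (hr : ∀ k, r k ≤ b) :
    IsFrame r V := by
  obtain ⟨U', S', V', hW, -, -, rfl⟩ := h
  exact hW.right.isFrame_truncCols hr

theorem IsTruncatedSVD.norm_sub_le (h : IsTruncatedSVD r W U S V) {X : Tensor a b c}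
    {U' : Tensor a (maxRank r) c} (hU' : IsFrame r U') {T : Tensor (maxRank r) b c}
    (hX : X = U' ∗ₜ T) : ‖W - U ∗ₜ S ∗ₜ tr V‖ ≤ ‖W - X‖ := by
  obtain ⟨U₀, S₀, V₀, hW, rfl, rfl, rfl⟩ := h
  refine norm_le_norm_of_hat fun k => ?_
  have hat_W : hat W k = hat U₀ k * hat S₀ k * (hat V₀ k)ᵀ := by
    rw [hW.eq, hat_tprod, hat_tprod, hat_tr]
  have hat_truncation :
      hat (truncCols r U₀ ∗ₜ truncDiag r S₀ ∗ₜ tr (truncCols r V₀)) k =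
        hat U₀ k * (selection a a (r k) * hat S₀ k) * (hat V₀ k)ᵀ := by
    rw [hat_tprod, hat_tprod, hat_tr, hat_truncCols, hat_truncCols, hat_truncDiag hW.diagonal,
      ← selection_mul_mul_selection (hW.isSingularValueMatrix k).diagonal,
      ← selection_mul_selection (a := a) (d := a) (le_maxRank r k),
      ← selection_mul_selection (a := b) (d := b) (le_maxRank r k), transpose_mul,
      selection_transpose]
    simp only [Matrix.mul_assoc]
  have fixed : hat U' k * (hat U' k)ᵀ * hat X k = hat X k := by
    rw [hX, ← hat_tr, ← hat_tprod, ← hat_tprod, ← tprod_assoc, tprod_assoc U', hU'.tprod_tr_tprod]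
  rw [hat_sub, hat_sub, hat_W, hat_truncation]
  exact eckart_young (hW.left.hat_transpose_mul_hat k) (hW.right.hat_transpose_mul_hat k)
    (hW.isSingularValueMatrix k) (hU'.isStarProjection_hat k) (hU'.trace_hat_mul_transpose k) fixed

end Truncation

/-! ### The sampling operator -/

section Sampling

variable {a b c m : ℕ} (Ω : Fin m → Fin a × Fin b × Fin c)

theorem isPositive_samplingOp : (samplingOp Ω).IsPositive :=
  ContinuousLinearMap.isPositive_sum _ fun _ _ => InnerProductSpace.isPositive_rankOne_self _

theorem inner_samplingOp (x y : Tensor a b c) :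
    ⟪x, samplingOp Ω y⟫_ℝ = ∑ t, x (Ω t) * y (Ω t) := by
  simp [samplingOp, unitTensor, inner_sum, inner_smul_right, EuclideanSpace.inner_single_left,
    EuclideanSpace.inner_single_right, mul_comm]

theorem sum_sq_le_norm_samplingOp_mul (x : Tensor a b c) :
    ∑ t, x (Ω t) ^ 2 ≤ ‖samplingOp Ω‖ * ‖x‖ ^ 2 := by
  calc ∑ t, x (Ω t) ^ 2 = ⟪x, samplingOp Ω x⟫_ℝ := by simp only [inner_samplingOp, sq]
    _ ≤ ‖x‖ * ‖samplingOp Ω x‖ := real_inner_le_norm _ _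
    _ ≤ ‖x‖ * (‖samplingOp Ω‖ * ‖x‖) := by gcongr; exact (samplingOp Ω).le_opNorm x
    _ = ‖samplingOp Ω‖ * ‖x‖ ^ 2 := by ring

theorem one_le_norm_samplingOp (hm : 0 < m) : 1 ≤ ‖samplingOp Ω‖ := by
  let t₀ : Fin m := ⟨0, hm⟩
  have hnorm : ‖unitTensor (Ω t₀)‖ = 1 := by simp [unitTensor]
  calc (1 : ℝ) = unitTensor (Ω t₀) (Ω t₀) ^ 2 := by simp [unitTensor]
    _ ≤ ∑ t, unitTensor (Ω t₀) (Ω t) ^ 2 :=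
        Finset.single_le_sum (f := fun t => unitTensor (Ω t₀) (Ω t) ^ 2)
          (fun _ _ => sq_nonneg _) (Finset.mem_univ t₀)
    _ ≤ ‖samplingOp Ω‖ := by
        simpa only [hnorm, one_pow, mul_one] using
          sum_sq_le_norm_samplingOp_mul Ω (unitTensor (Ω t₀))

theorem rate_le_norm_samplingOp (hm : 0 < m) :
    (m : ℝ) / ((a : ℝ) * b * c) ≤ ‖samplingOp Ω‖ := by
  have ha : 0 < a := (Ω ⟨0, hm⟩).1.pos
  have hb : 0 < b := (Ω ⟨0, hm⟩).2.1.pos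
  have hc : 0 < c := (Ω ⟨0, hm⟩).2.2.pos
  let ones : Tensor a b c := mk fun _ _ _ => 1
  have norm_sq_ones : ‖ones‖ ^ 2 = (a : ℝ) * b * c := by
    rw [EuclideanSpace.norm_sq_eq]
    simp [ones, mul_assoc]
  rw [div_le_iff₀ (by positivity), ← norm_sq_ones]
  simpa [ones] using sum_sq_le_norm_samplingOp_mul Ω ones

end Sampling

/-! ### Convergence -/

section Convergence

variable {a b c m : ℕ} {Ω : Fin m → Fin a × Fin b × Fin c} {X : Tensor a b c} {r : Fin c → ℕ}
  {U : Tensor a (maxRank r) c} {S : Tensor (maxRank r) (maxRank r) c} {V : Tensor b (maxRank r) c}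
  {k₁ k₂ p L δ ε : ℝ} {l : ℕ}

theorem IsSkinnySVD.rank_le_left (h : IsSkinnySVD r X U S V) (k : Fin c) : r k ≤ a := by
  rw [← congrFun h.multiRank_eq k]
  exact (Matrix.rank_le_card_height (hat X k)).trans_eq (Fintype.card_fin a)

theorem IsSkinnySVD.rank_le_right (h : IsSkinnySVD r X U S V) (k : Fin c) : r k ≤ b := by
  rw [← congrFun h.multiRank_eq k]
  exact (Matrix.rank_le_card_width (hat X k)).trans_eq (Fintype.card_fin b)

theorem IsSkinnySVD.maxRank_eq_zero (h : IsSkinnySVD r (0 : Tensor a b c) U S V) :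
    maxRank r = 0 := by
  refine Nat.le_zero.1 (Finset.sup_le fun k _ => ?_)
  rw [← congrFun h.multiRank_eq k]
  exact (congrArg Matrix.rank (hat_zero k)).trans_le Matrix.rank_zero.le

theorem tprod_eq_zero_of_innerDim_eq_zero {d : ℕ} (hd : d = 0) (A : Tensor a d c)
    (B : Tensor d b c) : A ∗ₜ B = 0 := by
  subst hd
  refine hat_ext fun k => ?_
  ext i j
  simp [hat_tprod, hat_zero, Matrix.mul_apply]

theorem Run.isFrame_left (run : Run Ω X r k₁ k₂) : ∀ l, IsFrame r (run.U l)
  | 0 => run.init.left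
  | l + 1 => (run.trunc l).isFrame_left run.init.rank_le_left

theorem Run.isFrame_right (run : Run Ω X r k₁ k₂) : ∀ l, IsFrame r (run.V l)
  | 0 => run.init.right
  | l + 1 => (run.trunc l).isFrame_right run.init.rank_le_right

theorem Run.iter_eq (run : Run Ω X r k₁ k₂) :
    ∀ l, run.iter l = run.U l ∗ₜ run.S l ∗ₜ tr (run.V l)
  | 0 => run.init.eq
  | l + 1 => run.iter_succ l

theorem Run.iter_eq_zero (run : Run Ω 0 r k₁ k₂) (h : IsSkinnySVD r (0 : Tensor a b c) U S V)
    (l : ℕ) : run.iter l = 0 := by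
  rw [run.iter_eq]
  exact tprod_eq_zero_of_innerDim_eq_zero h.maxRank_eq_zero _ _

theorem Run.norm_iter_succ_sub_le (run : Run Ω X r k₁ k₂) (hX : IsSkinnySVD r X U S V) (l : ℕ) :
    ‖run.iter (l + 1) - X‖ ≤ 2 * ‖(run.iter l - X) + run.α l • run.Q l‖ := by
  have best : ‖run.W l - run.iter (l + 1)‖ ≤ ‖run.W l - X‖ := by
    rw [run.iter_succ]
    exact (run.trunc l).norm_sub_le hX.left (hX.eq.trans (tprod_assoc _ _ _))
  have error : (run.iter l - X) + run.α l • run.Q l = run.W l - X := by rw [run.W_eq]; abel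
  rw [error]
  linarith [norm_sub_le_norm_sub_add_norm_sub (run.iter (l + 1)) (run.W l) X,
    norm_sub_rev (run.iter (l + 1)) (run.W l)]

/-- The tangent space at the `l`-th iterate. -/
def Run.tangent (run : Run Ω X r k₁ k₂) (l : ℕ) : Submodule ℝ (Tensor a b c) :=
  tangentSpace (run.U l) (run.V l)

theorem Run.tangentProj_eq (run : Run Ω X r k₁ k₂) (l : ℕ) :
    tangentProj (run.U l) (run.V l) = (run.tangent l).starProjection :=
  (starProjection_tangentSpace (run.isFrame_left l) (run.isFrame_right l)).symm

theorem Run.isConjCoeff (run : Run Ω X r k₁ k₂) (l : ℕ) :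
    IsConjCoeff (samplingOp Ω) k₁ k₂ ((run.tangent l).starProjection (run.G l))
      ((run.tangent l).starProjection (prevDir run.Q l)) (run.β l) := by
  rw [← run.tangentProj_eq]
  rcases eq_or_ne l 0 with rfl | hl
  · exact Or.inl run.β_zero
  · exact (em _).symm.imp (run.β_restart l) fun keep => ⟨keep, run.β_keep l hl keep⟩

theorem Run.Q_eq_starProjection (run : Run Ω X r k₁ k₂) (l : ℕ) :
    run.Q l = (run.tangent l).starProjection (run.G l) +
      run.β l • (run.tangent l).starProjection (prevDir run.Q l) := by
  rw [← run.tangentProj_eq]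
  exact run.Q_eq l

theorem Run.α_eq_inner (run : Run Ω X r k₁ k₂) (l : ℕ) :
    run.α l = ⟪(run.tangent l).starProjection (run.G l), run.Q l⟫_ℝ /
      ⟪run.Q l, samplingOp Ω (run.Q l)⟫_ℝ := by
  have mem : run.Q l ∈ run.tangent l := by
    rw [run.Q_eq_starProjection]
    exact Submodule.add_mem _ (Submodule.starProjection_apply_mem _ _)
      (Submodule.smul_mem _ _ (Submodule.starProjection_apply_mem _ _))
  rw [run.α_eq, run.tangentProj_eq, Submodule.starProjection_eq_self_iff.2 mem]

theorem Run.starProjection_G (run : Run Ω X r k₁ k₂) (l : ℕ) :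
    (run.tangent l).starProjection (run.G l) =
      -(run.tangent l).starProjection (samplingOp Ω (run.iter l - X)) := by
  rw [run.G_eq, ← neg_sub (run.iter l), map_neg, map_neg]

theorem Run.norm_sub_add_smul_Q_le (run : Run Ω X r k₁ k₂)
    (hiso : RestrictedIsometry (run.tangent l) (samplingOp Ω) p δ) (hp : 0 < p)
    (htangent : IsNearlyTangent (run.tangent l) (samplingOp Ω) p ε (run.iter l - X))
    (hk₁ : 0 ≤ k₁) (hk₂ : 0 ≤ k₂) (hdev : 0 < (1 - δ) - k₁ * (1 + δ)) :
    ‖(run.iter l - X) + run.α l • run.Q l‖ ≤ gradientRate k₁ δ ε * ‖run.iter l - X‖ +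
      conjWeight k₁ k₂ δ * ((1 + stepsizeDev k₁ δ) * p⁻¹ * ‖prevDir run.Q l‖) := by
  have hδ := hiso.nonneg
  have hδ₁ : 0 < 1 - δ := hdev.trans_le (sub_le_self _ (by positivity))
  have gradient_mem := (run.tangent l).starProjection_apply_mem (run.G l)
  have prev_mem := (run.tangent l).starProjection_apply_mem (prevDir run.Q l)
  obtain ⟨a', step_eq, ha'⟩ := (run.isConjCoeff l).exists_smul_eq_stepsize hiso hp hk₁ hdev
    gradient_mem prev_mem (run.Q_eq_starProjection l)
  rw [run.α_eq_inner, step_eq, run.Q_eq_starProjection, run.starProjection_G]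
  refine (norm_add_smul_direction_le hiso hp htangent ha' ((run.isConjCoeff l).abs_le hiso hp
    (sub_pos.1 hδ₁) hk₁ hk₂ gradient_mem prev_mem)).trans ?_
  have := stepsizeDev_nonneg hδ hdev
  have := conjWeight_nonneg hδ (sub_pos.1 hδ₁) hk₁ hk₂
  gcongr
  · rfl
  · exact Submodule.norm_starProjection_apply_le _ _

theorem Run.norm_Q_le (run : Run Ω X r k₁ k₂)
    (hiso : RestrictedIsometry (run.tangent l) (samplingOp Ω) p δ) (hp : 0 < p)
    (htangent : IsNearlyTangent (run.tangent l) (samplingOp Ω) p ε (run.iter l - X))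
    (hk₁ : 0 ≤ k₁) (hk₂ : 0 ≤ k₂) (hdev : 0 < (1 - δ) - k₁ * (1 + δ)) :
    (1 + stepsizeDev k₁ δ) * p⁻¹ * ‖run.Q l‖ ≤ (1 + gradientRate k₁ δ ε) * ‖run.iter l - X‖ +
      conjWeight k₁ k₂ δ * ((1 + stepsizeDev k₁ δ) * p⁻¹ * ‖prevDir run.Q l‖) := by
  have hδ := hiso.nonneg
  have hδ₁ : 0 < 1 - δ := hdev.trans_le (sub_le_self _ (by positivity))
  have dev_nonneg := stepsizeDev_nonneg hδ hdev
  rw [run.Q_eq_starProjection, run.starProjection_G]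
  refine (norm_direction_le hiso hp htangent dev_nonneg ((run.isConjCoeff l).abs_le hiso hp
    (sub_pos.1 hδ₁) hk₁ hk₂ (Submodule.starProjection_apply_mem _ _)
    (Submodule.starProjection_apply_mem _ _))).trans ?_
  have := conjWeight_nonneg hδ (sub_pos.1 hδ₁) hk₁ hk₂
  gcongr
  · rfl
  · exact Submodule.norm_starProjection_apply_le _ _

section Basin

variable (run : Run Ω X r k₁ k₂) (hX : IsSkinnySVD r X U S V) (hX₀ : X ≠ 0)
  (hiso : RestrictedIsometry (tangentSpace U V) (samplingOp Ω) p ε) (hp : 0 < p) (hpL : p ≤ L)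
  (hL : 1 ≤ L) (hRL : ‖samplingOp Ω‖ ≤ L)
  (hnear : 2 * (‖run.iter l - X‖ / sigmaMin X) * (L * (1 + ε)) ≤ √p * ε)

include hX hX₀ hiso hp hpL hL hRL hnear

theorem Run.restrictedIsometry_tangent :
    RestrictedIsometry (run.tangent l) (samplingOp Ω) p (4 * ε) :=
  hiso.of_norm_sub_le (isPositive_samplingOp Ω) hp hpL hL hRL hnear
    (hX.norm_starProjection_tangentSpace_sub_le hX₀ (run.isFrame_left l) (run.isFrame_right l)
      (run.iter_eq l))

theorem Run.isNearlyTangent_iter_sub :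
    IsNearlyTangent (run.tangent l) (samplingOp Ω) p ε (run.iter l - X) := by
  refine hiso.isNearlyTangent (isPositive_samplingOp Ω) hp hpL hL hRL hnear
    (hX.norm_starProjection_tangentSpace_sub_le hX₀ (run.isFrame_left l) (run.isFrame_right l)
      (run.iter_eq l)) ?_
  rw [mul_div_cancel_left₀ _ two_ne_zero]
  exact hX.norm_sub_starProjection_tangentSpace_le hX₀ (run.isFrame_left l) (run.isFrame_right l)
    (run.iter_eq l)

end Basin

theorem Run.norm_iter_sub_le (run : Run Ω X r k₁ k₂) (hX : IsSkinnySVD r X U S V) (hX₀ : X ≠ 0)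
    (hiso : RestrictedIsometry (tangentSpace U V) (samplingOp Ω) p ε) (hp : 0 < p) (hpL : p ≤ L)
    (hL : 1 ≤ L) (hRL : ‖samplingOp Ω‖ ≤ L)
    (hnear : 2 * (‖run.iter 0 - X‖ / sigmaMin X) * (L * (1 + ε)) ≤ √p * ε)
    (hk₁ : 0 ≤ k₁) (hk₂ : 0 ≤ k₂) (hdev : 0 < (1 - 4 * ε) - k₁ * (1 + 4 * ε))
    (hv : vcg k₁ k₂ ε ≤ 1) (l : ℕ) :
    ‖run.iter l - X‖ ≤ vcg k₁ k₂ ε ^ l * ‖run.iter 0 - X‖ := by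
  have hε := hiso.nonneg
  have hε₁ : 4 * ε < 1 := sub_pos.1 (hdev.trans_le (sub_le_self _ (by positivity)))
  have rate_nonneg := gradientRate_nonneg (by positivity) hε hdev
  have weight_nonneg := conjWeight_nonneg (by positivity) hε₁ hk₁ hk₂
  have hγ₂ : 0 ≤ gamma₂ k₁ k₂ ε := gamma₂_eq ▸ mul_nonneg zero_le_two weight_nonneg
  have rate_le := gamma₁_le_vcg hγ₂
  have rate_sq := vcg_sq hγ₂
  rw [gamma₁_eq hdev] at rate_le rate_sq
  rw [gamma₂_eq] at rate_sq
  have near : ∀ l, ‖run.iter l - X‖ ≤ ‖run.iter 0 - X‖ →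
      2 * (‖run.iter l - X‖ / sigmaMin X) * (L * (1 + ε)) ≤ √p * ε := by
    intro l hl
    refine le_trans ?_ hnear
    have := sigmaMin_nonneg X
    gcongr
  refine le_pow_mul_of_coupled_recursion (d := fun l => ‖run.iter l - X‖)
    (s := fun l => 2 * ((1 + stepsizeDev k₁ (4 * ε)) * p⁻¹ * ‖prevDir run.Q l‖))
    (mul_nonneg zero_le_two rate_nonneg) weight_nonneg (by linarith) rate_sq hv (norm_nonneg _)
    (by simp [prevDir]) (fun l hl => ?_) (fun l hl => ?_) l
  all_goals
    have isometry := run.restrictedIsometry_tangent hX hX₀ hiso hp hpL hL hRL (near l hl)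
    have tangent := run.isNearlyTangent_iter_sub hX hX₀ hiso hp hpL hL hRL (near l hl)
  · linarith [run.norm_iter_succ_sub_le hX l,
      run.norm_sub_add_smul_Q_le isometry hp tangent hk₁ hk₂ hdev]
  · have prevDir_succ : prevDir run.Q (l + 1) = run.Q l := rfl
    simp only [prevDir_succ]
    linarith [run.norm_Q_le isometry hp tangent hk₁ hk₂ hdev]

theorem Run.vcg_lt_one_and_norm_iter_sub_le (run : Run Ω X r k₁ k₂) (hm : 0 < m)
    (hX : IsSkinnySVD r X U S V) (hp : p = (m : ℝ) / ((a : ℝ) * b * c)) (hk₁ : 0 ≤ k₁)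
    (hk₂ : 0 ≤ k₂) (hRL : ‖samplingOp Ω‖ ≤ L)
    (hiso : ‖tangentProj U V - p⁻¹ • (tangentProj U V ∘L samplingOp Ω ∘L tangentProj U V)‖ ≤ ε)
    (hnear : ‖run.iter 0 - X‖ / sigmaMin X ≤ √p * ε / (2 * L * (1 + ε)))
    (hdev : 0 < (1 - 4 * ε) - k₁ * (1 + 4 * ε)) (hγ : gamma₁ k₁ k₂ ε + gamma₂ k₁ k₂ ε < 1) :
    vcg k₁ k₂ ε < 1 ∧ ∀ l, ‖run.iter l - X‖ ≤ vcg k₁ k₂ ε ^ l * ‖run.iter 0 - X‖ := by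
  have hε : 0 ≤ ε := (norm_nonneg _).trans hiso
  have hε₁ : 4 * ε < 1 := sub_pos.1 (hdev.trans_le (sub_le_self _ (by positivity)))
  have hγ₂ : 0 ≤ gamma₂ k₁ k₂ ε :=
    gamma₂_eq ▸ mul_nonneg zero_le_two (conjWeight_nonneg (by positivity) hε₁ hk₁ hk₂)
  have hv := vcg_lt_one hγ₂ hγ
  refine ⟨hv, fun l => ?_⟩
  rcases eq_or_ne X 0 with rfl | hX₀
  · simp [run.iter_eq_zero hX]
  obtain ⟨i, j, k⟩ := Ω ⟨0, hm⟩
  have hp₀ : 0 < p := by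
    have := i.pos
    have := j.pos
    have := k.pos
    rw [hp]
    positivity
  have hL := (one_le_norm_samplingOp Ω hm).trans hRL
  have hpL : p ≤ L := hp.trans_le ((rate_le_norm_samplingOp Ω hm).trans hRL)
  refine run.norm_iter_sub_le hX hX₀ (p := p) ?_ hp₀ hpL hL hRL ?_ hk₁ hk₂ hdev hv.le l
  · rwa [RestrictedIsometry, starProjection_tangentSpace hX.left hX.right]
  · rw [le_div_iff₀ (by positivity)] at hnear
    linarith

end Convergence

end TensorRCG

end

open TensorRCG Filter Topology in
theorem theorem3p1_general :
    (∀ (n₁ n₂ n₃ m : ℕ) (_ : 0 < m) (Ω : Fin m → Fin n₁ × Fin n₂ × Fin n₃)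
      (r : Fin n₃ → ℕ) (X : Tensor n₁ n₂ n₃) (U : Tensor n₁ (maxRank r) n₃)
      (S : Tensor (maxRank r) (maxRank r) n₃) (V : Tensor n₂ (maxRank r) n₃)
      (_ : IsSkinnySVD r X U S V)
      (p : ℝ) (_ : p = (m : ℝ) / ((n₁ : ℝ) * n₂ * n₃))
      (L ε₀ k₁ k₂ : ℝ) (_ : 0 ≤ k₁) (_ : 0 ≤ k₂)
      (run : Run Ω X r k₁ k₂)
      (_ : ‖samplingOp Ω‖ ≤ L)
      (_ : ‖tangentProj U V - p⁻¹ • (tangentProj U V ∘L samplingOp Ω ∘L tangentProj U V)‖ ≤ ε₀)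
      (_ : ‖run.iter 0 - X‖ / sigmaMin X ≤ √p * ε₀ / (2 * L * (1 + ε₀)))
      (_ : 0 < (1 - 4 * ε₀) - k₁ * (1 + 4 * ε₀))
      (_ : gamma₁ k₁ k₂ ε₀ + gamma₂ k₁ k₂ ε₀ < 1),
      vcg k₁ k₂ ε₀ < 1 ∧
        ∀ l : ℕ, ‖run.iter l - X‖ ≤ vcg k₁ k₂ ε₀ ^ l * ‖run.iter 0 - X‖) ∧
    (∀ ε₀ : ℝ, 0 ≤ ε₀ → 4 * ε₀ < 1 →
      vcg 0 0 ε₀ = 18 * ε₀ / (1 - 4 * ε₀) ∧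
        (gamma₁ 0 0 ε₀ + gamma₂ 0 0 ε₀ < 1 → 18 * ε₀ / (1 - 4 * ε₀) < 1)) ∧
    (∀ k₁ k₂ : ℝ, k₁ ≠ 1 →
      Tendsto (fun ε₀ => gamma₁ k₁ k₂ ε₀ + gamma₂ k₁ k₂ ε₀) (𝓝 0) (𝓝 (3 * k₁ * k₂))) ∧
    (∀ k₁ k₂ : ℝ, k₁ * k₂ < 1 / 3 →
      ∀ᶠ ε₀ in 𝓝[>] 0, gamma₁ k₁ k₂ ε₀ + gamma₂ k₁ k₂ ε₀ < 1) ∧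
    (∀ ε₀ : ℝ, 0 ≤ ε₀ → ε₀ ≤ 0.01 →
      0 < (1 - 4 * ε₀) - 0.1 * (1 + 4 * ε₀) ∧
        gamma₁ 0.1 1 ε₀ + gamma₂ 0.1 1 ε₀ < 1) := by
  refine ⟨?_, ?_, ?_, ?_, ?_⟩
  · intro n₁ n₂ n₃ m hm Ω r X U S V hX p hp L ε₀ k₁ k₂ hk₁ hk₂ run hRL hiso hnear hdev hγ
    exact run.vcg_lt_one_and_norm_iter_sub_le hm hX hp hk₁ hk₂ hRL hiso hnear hdev hγ
  · exact fun ε₀ hε hε₁ => ⟨vcg_zero_zero hε hε₁.le, fun hγ =>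
      vcg_zero_zero hε hε₁.le ▸ vcg_lt_one (by simp [gamma₂]) hγ⟩
  · exact fun k₁ k₂ => tendsto_gamma₁_add_gamma₂
  · exact fun k₁ k₂ => eventually_gamma₁_add_gamma₂_lt_one
  · exact fun ε₀ hε hε₁ => ⟨by linarith, gamma₁_add_gamma₂_lt_one_of_le hε hε₁⟩

open TensorRCG Filter Topology in
theorem theorem3p1 :
    -- convergence
    (∀ (n₁ n₂ n₃ m : ℕ) (_ : 0 < m) (Ω : Fin m → Fin n₁ × Fin n₂ × Fin n₃)
      (r : Fin n₃ → ℕ) (X : Tensor n₁ n₂ n₃) (U : Tensor n₁ (maxRank r) n₃)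
      (S : Tensor (maxRank r) (maxRank r) n₃) (V : Tensor n₂ (maxRank r) n₃)
      (_ : IsSkinnySVD r X U S V)
      (p : ℝ) (_ : p = (m : ℝ) / ((n₁ : ℝ) * n₂ * n₃))
      (n : ℕ) (_ : n = max n₁ (max n₂ n₃))
      (β ε₀ k₁ k₂ : ℝ) (_ : 1 < β) (_ : 0 < ε₀) (_ : 0 ≤ k₁) (_ : 0 ≤ k₂)
      (run : Run Ω X r k₁ k₂)
      (_ : ‖samplingOp Ω‖ ≤ 10 / 3 * β * Real.log n)
      (_ : ‖tangentProj U V - p⁻¹ • (tangentProj U V ∘L samplingOp Ω ∘L tangentProj U V)‖ ≤ ε₀)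
      (_ : ‖run.iter 0 - X‖ / sigmaMin X ≤
        3 * Real.sqrt p * ε₀ / (20 * β * (1 + ε₀) * Real.log n))
      (_ : 0 < (1 - 4 * ε₀) - k₁ * (1 + 4 * ε₀))
      (_ : gamma₁ k₁ k₂ ε₀ + gamma₂ k₁ k₂ ε₀ < 1),
      vcg k₁ k₂ ε₀ < 1 ∧
        ∀ l : ℕ, ‖run.iter l - X‖ ≤ vcg k₁ k₂ ε₀ ^ l * ‖run.iter 0 - X‖) ∧
    -- the case of no conjugation
    (∀ ε₀ : ℝ, 0 < ε₀ → 4 * ε₀ < 1 →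
      vcg 0 0 ε₀ = 18 * ε₀ / (1 - 4 * ε₀) ∧
        (gamma₁ 0 0 ε₀ + gamma₂ 0 0 ε₀ < 1 → 18 * ε₀ / (1 - 4 * ε₀) < 1)) ∧
    -- the limit of the constants
    (∀ k₁ k₂ : ℝ, 0 ≤ k₁ → 0 ≤ k₂ → k₁ ≠ 1 →
      Tendsto (fun ε₀ => gamma₁ k₁ k₂ ε₀ + gamma₂ k₁ k₂ ε₀) (𝓝 0) (𝓝 (3 * k₁ * k₂))) ∧
    (∀ k₁ k₂ : ℝ, 0 ≤ k₁ → 0 ≤ k₂ → k₁ * k₂ < 1 / 3 →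
      ∀ᶠ ε₀ in 𝓝[>] 0, gamma₁ k₁ k₂ ε₀ + gamma₂ k₁ k₂ ε₀ < 1) ∧
    -- the standard parameters
    (∀ ε₀ : ℝ, 0 < ε₀ → ε₀ ≤ 0.01 →
      0 < (1 - 4 * ε₀) - 0.1 * (1 + 4 * ε₀) ∧
        gamma₁ 0.1 1 ε₀ + gamma₂ 0.1 1 ε₀ < 1) := by
  obtain ⟨convergence, no_conj, limit, small, standard⟩ := theorem3p1_general
  refine ⟨?_, fun ε₀ hε => no_conj ε₀ hε.le, fun k₁ k₂ _ _ => limit k₁ k₂,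
    fun k₁ k₂ _ _ => small k₁ k₂, fun ε₀ hε => standard ε₀ hε.le⟩
  intro n₁ n₂ n₃ m hm Ω r X U S V hX p hp n hn β ε₀ k₁ k₂ hβ hε hk₁ hk₂ run hR hiso hnear
  refine convergence n₁ n₂ n₃ m hm Ω r X U S V hX p hp _ ε₀ k₁ k₂ hk₁ hk₂ run hR hiso
    (hnear.trans_eq ?_)
  field_simp
  ring
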